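/- **Setting.** Let $n\ge 1$ and $\delta\in(0,1)$. For $\xi\in\mathbb S^{n-1}$ put $V_\xi=\{z\in\mathbb R^n\setminus\{0\}:|\tfrac{z}{|z|}\cdot\xi|\ge\delta\}$ and $R(0,V_\xi)=(B_1\setminus B_{1/2})\cap V_\xi$. For $0<\lambda\le\Lambda$ and $\alpha\in(0,2)$ let $\mathcal A_{sec}$ be the class of measurable kernels $K:\mathbb R^n\to\mathbb R$ with $K(-h)=K(h)$ for which there is $\xi\in\mathbb S^{n-1}$ with $$\mathbf 1_{V_\xi}(h)\frac{\lambda(2-\alpha)}{|h|^{n+\alpha}}\le K(h)\le\frac{\Lambda(2-\alpha)}{|h|^{n+\alpha}}\qquad(h\ne0),$$ and let $$M^+_{\mathcal A_{sec}}v(x)=\sup_{K\in\mathcal A_{sec}}\int_{\mathbb R^n}\bigl(v(x+h)+v(x-h)-2v(x)\bigr)K(h)\,dh,$$ where the value $-\infty$ of an integral is allowed. Let $f\in C(\overline{B_1})$, $f\ge0$, and let $u:\mathbb R^n\to\mathbb R$ be a measurable function which satisfies $$M^+_{\mathcal A_{sec}}u\ge -f\ \text{ in }B_1,\qquad u\le0\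 \text{ on }\mathbb R^n\setminus B_1,$$ the first inequality in the viscosity sense. This means that $u$ is upper semicontinuous on $\overline{B_1}$ and that, whenever $x\in N\subset B_1$ with $N$ open and $\varphi\in C^2(\mathbb R^n)$ satisfies $\varphi(x)=u(x)$ and $\varphi>u$ in $N\setminus\{x\}$, the function $v$ equal to $\varphi$ in $N$ and to $u$ outside $N$ satisfies $M^+_{\mathcal A_{sec}}v(x)\ge-f(x)$. Let $\Gamma$ be the concave envelope of $u^+$ in $B_3$: for $x\in B_3$, $\Gamma(x)=\inf\{p(x):p\text{ affine},\ p\ge u^+\text{ in }B_3\}$, and $\Gamma=0$ outside $B_3$. Let $\Sigma=\{u=\Gamma\}\cap B_1$ be the contact set. For $E\subset\mathbb R^n$ let $\nabla\Gamma(E)$ be the union over $x\in E$ of the superdifferentials $\{p\in\mathbb R^n:\Gamma(y)\le\Gamma(x)+p\cdot(y-x)\ \forall y\in B_3\}$. Cubes have edges parallel to the axes, and $tQ$ is the cube with the centre of $Q$ and $t$ times its side length. The supremum of $f$ over a set $E$ is taken over $E\cap\overline{B_1}$, where $f$ is given. **The radius $l$.** Call $l\in(0,\tfrac12)$ admissible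 (for $n,\delta$) if there is $\varepsilon_0>0$ such that for every $\xi\in\mathbb S^{n-1}$, every concave $G:B_1\to\mathbb R$, every $p$ in the superdifferential of $G$ at $0$ and every $b>0$, $$|\{z\in R(0,V_\xi):G(z)<G(0)+p\cdot z-b\}|\le\varepsilon_0|R(0,V_\xi)|\ \Longrightarrow\ G(y)\ge G(0)+p\cdot y-b\ \text{ for all }y\in B_l .$$ **Theorem.** For all $n\ge1$ and $\delta\in(0,1)$ an admissible $l$ exists. Fix any admissible $l$, set $\eta=(1+\tfrac8l)\sqrt n$, and let $0<\rho_0\le\tfrac{l}{16n}$. There are constants $C_2\ge1$, depending only on $\delta,\lambda,\rho_0,n$ (and $l$), and $\nu>0$, depending only on $\delta,n$ (and $l$), such that for all $\Lambda\ge\lambda$, $\alpha\in(0,2)$, $f$ and $u$ as above there is a finite, possibly empty family of pairwise disjoint open cubes $Q^1,\dots,Q^m$ with diameters $0<d_j\le\rho_0 2^{-1/(2-\alpha)}$ whose closures cover $\Sigma$, and for every $j$: 1. $\Sigma\cap\overline{Q^j}\ne\emptyset$; 2. $|\nabla\Gamma(\overline{Q^j})|\le C_2\bigl(\sup_{\overline{Q^j}}f\bigr)^n|Q^j|$;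 3. $\bigl|\{y\in\eta Q^j:u(y)\ge\Gamma(y)-C_2(\sup_{\overline{Q^j}}f)\,d_j^2\}\bigr|\ge\nu\,|\eta Q^j|$. -/

import Mathlib

open MeasureTheory Set Metric

namespace NonlocalABP

noncomputable section

/-- `ℝⁿ` with the Euclidean norm. -/
abbrev Rn (n : ℕ) := EuclideanSpace ℝ (Fin n)

/-- The double cone `V_ξ = {z : |(z/|z|) · ξ| ≥ δ}`. For `δ > 0` it does not contain the origin. -/
def sector {n : ℕ} (δ : ℝ) (ξ : Rn n) : Set (Rn n) :=
  {z | δ ≤ |inner ℝ (‖z‖⁻¹ • z) ξ|}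

/-- The class `A_sec` of even kernels `K` for which there is a direction `ξ` on the unit sphere with
`1_{V_ξ}(h) λ (2-α) |h|^{-n-α} ≤ K(h) ≤ Λ (2-α) |h|^{-n-α}` for `h ≠ 0`. -/
def sectorKernels (n : ℕ) (δ lam Lam α : ℝ) : Set (Rn n → ℝ) :=
  {K | AEMeasurable K volume ∧ (∀ h, K (-h) = K h) ∧
    ∃ ξ : Rn n, ‖ξ‖ = 1 ∧ ∀ h : Rn n, h ≠ 0 →
      (sector δ ξ).indicator (fun z => lam * (2 - α) / ‖z‖ ^ ((n : ℝ) + α)) h ≤ K h ∧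
      K h ≤ Lam * (2 - α) / ‖h‖ ^ ((n : ℝ) + α)}

/-- `δ²_h v(x) = v(x+h) + v(x-h) - 2 v(x)`. -/
def secondDiff {n : ℕ} (v : Rn n → ℝ) (x h : Rn n) : ℝ :=
  v (x + h) + v (x - h) - 2 * v x

/-- `L_K v(x) = ∫ δ²_h v(x) K(h) dh`, with values in the extended reals: the integral of the positive
part minus that of the negative part (for a nonnegative kernel `K`). When `v` is bounded above and
touched from above at `x` by a paraboloid, the first integral is finite for every `K` of the class
`sectorKernels`, so the difference is never of the form `∞ - ∞`. -/
def nonlocalOp {n : ℕ} (K : Rn n → ℝ) (v : Rn n → ℝ) (x : Rn n) : EReal :=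
  ((∫⁻ h, ENNReal.ofReal (secondDiff v x h) * ENNReal.ofReal (K h) : ENNReal) : EReal) -
  ((∫⁻ h, ENNReal.ofReal (-secondDiff v x h) * ENNReal.ofReal (K h) : ENNReal) : EReal)

/-- The maximal operator `M⁺ v(x) = sup_{K ∈ A_sec} L_K v(x)`. -/
def maxOp {n : ℕ} (δ lam Lam α : ℝ) (v : Rn n → ℝ) (x : Rn n) : EReal :=
  ⨆ K ∈ sectorKernels n δ lam Lam α, nonlocalOp K v x

open Classical in
/-- `M⁺ u ≥ -f` in `Ω` in the viscosity sense: `u` is upper semicontinuous on the closure of `Ω`, and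
whenever a `C²` function `φ` touches `u` strictly from above at `x ∈ Ω` in an open neighbourhood
`N ⊆ Ω` of `x`, the function equal to `φ` in `N` and to `u` elsewhere satisfies the inequality
at `x`. -/
def IsViscositySubsolution {n : ℕ} (δ lam Lam α : ℝ) (Ω : Set (Rn n)) (f u : Rn n → ℝ) : Prop :=
  UpperSemicontinuousOn u (closure Ω) ∧
  ∀ x ∈ Ω, ∀ N : Set (Rn n), IsOpen N → x ∈ N → N ⊆ Ω →
    ∀ φ : Rn n → ℝ, ContDiff ℝ 2 φ → φ x = u x → (∀ y ∈ N, y ≠ x → u y < φ y) →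
      ((-f x : ℝ) : EReal) ≤ maxOp δ lam Lam α (fun y => if y ∈ N then φ y else u y) x

open Classical in
/-- The concave envelope `Γ` of `u⁺` in `B₃`, extended by zero outside `B₃`. -/
def concaveEnv {n : ℕ} (u : Rn n → ℝ) (x : Rn n) : ℝ :=
  if x ∈ ball (0 : Rn n) 3 then
    sInf {t : ℝ | ∃ (a : Rn n) (b : ℝ),
      (∀ y ∈ ball (0 : Rn n) 3, max (u y) 0 ≤ inner ℝ a y + b) ∧ t = inner ℝ a x + b}
  else 0

/-- The contact set `{u = Γ} ∩ B₁`. -/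
def contactSet {n : ℕ} (u : Rn n → ℝ) : Set (Rn n) :=
  {x | u x = concaveEnv u x} ∩ ball 0 1

/-- The superdifferential at `x` of a function `G` on the set `D`. -/
def superdiff {n : ℕ} (D : Set (Rn n)) (G : Rn n → ℝ) (x : Rn n) : Set (Rn n) :=
  {p | ∀ y ∈ D, G y ≤ G x + inner ℝ p (y - x)}

/-- `∇Γ(E)`: the union over `x ∈ E` of the superdifferentials of `Γ` in `B₃`. -/
def gradImage {n : ℕ} (u : Rn n → ℝ) (E : Set (Rn n)) : Set (Rn n) :=
  ⋃ x ∈ E, superdiff (ball 0 3) (concaveEnv u) x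

/-- The open cube `Q_s(c) = {x : |x - c|_∞ < s/2}` with centre `c` and side length `s`. Thus `t Q` is
the cube `cube c (t * s)`. -/
def cube {n : ℕ} (c : Rn n) (s : ℝ) : Set (Rn n) :=
  {x | ∀ i, |x i - c i| < s / 2}

/-- The part `R(0, V_ξ)` of the ring `B₁ \ B_{1/2}` in the double cone `V_ξ`. -/
def ringSector {n : ℕ} (δ : ℝ) (ξ : Rn n) : Set (Rn n) :=
  (ball 0 1 \ ball 0 (1 / 2)) ∩ sector δ ξ

/-- The property that fixes the radius `l ∈ (0, 1/2)`: for some `ε₀ > 0`, a concave function on `B₁`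
that lies below a supporting plane at `0` by more than `b` only on an `ε₀`-fraction of
`R(0, V_ξ)` lies nowhere in `B_l` below that plane by more than `b`. -/
def IsSectorRadius (n : ℕ) (δ l : ℝ) : Prop :=
  0 < l ∧ l < 1 / 2 ∧ ∃ ε₀ : ℝ, 0 < ε₀ ∧
    ∀ ξ : Rn n, ‖ξ‖ = 1 →
    ∀ G : Rn n → ℝ, ConcaveOn ℝ (ball 0 1) G →
    ∀ p ∈ superdiff (ball 0 1) G 0, ∀ b : ℝ, 0 < b →
      volume {z ∈ ringSector δ ξ | G z < G 0 + inner ℝ p z - b} ≤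
        ENNReal.ofReal ε₀ * volume (ringSector δ ξ) →
      ∀ y ∈ ball (0 : Rn n) l, G 0 + inner ℝ p y - b ≤ G y

/-- The supremum over `E` of a function `f` given on the closed unit ball. -/
def supOn {n : ℕ} (f : Rn n → ℝ) (E : Set (Rn n)) : ℝ :=
  sSup (f '' (E ∩ closedBall 0 1))

end

end NonlocalABP

namespace NonlocalABP

/-! ### The ring sector and the sector radius -/

/-! At a contact point `x` with supergradient `p`, the function `u` lies below the plane of `Γ`
wherever `‖h‖ < 2`, and `u ≤ 0` outside `B₁`; hence every second difference of `u` at `x` is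
nonpositive. Testing the equation with this plane plus a small high power of `‖y - x‖` yields a
direction `ξ` for which the negative second differences, weighted by the lower kernel bound on the
cone, have integral at most `f x + e` (`exists_setLIntegral_secondDiff_le`).

Split this integral over rings of radii `r k = t 2^(-1/(2-α)) 2^(-k)`. If on every ring `u` were
more than `M (f x + e) (r k)²` below the plane on a fixed fraction, the rings would contribute a
multiple of `M (f x + e) (2 - α) ∑ (r k)^(2-α)`. The factor `2 - α` balances the geometric series,
so this exceeds `f x + e` for some `M` free of `α` and `Λ` (`exists_volume_badSet_le`). Hence one of
finitely many scales is good: `u` is near the plane on most of the ring sector. Since `Γ ≥ u`, the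
defining property of `l` makes `Γ` flat on a ball of radius `l r k`, and since `Γ` is below the
plane, `u` is near `Γ` on a set of measure comparable to `(r k)^n` (`exists_good_scale`).

Flatness confines the supergradients on a cube of side comparable to `r k` to a small ball
(`mem_closedBall_of_flat`). Both estimates thus hold on every cube of that side whose closure
contains `x`, whatever its position, so bisection stops after boundedly many steps
(`exists_isGoodCover`). That number may depend on `α`; the constants do not. -/

lemma sector_neg {n : ℕ} (δ : ℝ) (ξ : Rn n) : sector δ (-ξ) = sector δ ξ := by
  ext z
  simp [sector]

lemma ringSector_neg {n : ℕ} (δ : ℝ) (ξ : Rn n) : ringSector δ (-ξ) = ringSector δ ξ := by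
  rw [ringSector, sector_neg, ringSector]

lemma smul_mem_sector {n : ℕ} {δ : ℝ} {ξ z : Rn n} {r : ℝ} (hr : 0 < r) :
    r • z ∈ sector δ ξ ↔ z ∈ sector δ ξ := by
  have : ‖r • z‖⁻¹ • (r • z) = ‖z‖⁻¹ • z := by
    rw [norm_smul, Real.norm_of_nonneg hr.le, smul_smul]
    congr 1
    rw [mul_inv]
    field_simp
  simp only [sector, mem_ofPred_eq, this]

lemma measurableSet_sector {n : ℕ} (δ : ℝ) (ξ : Rn n) : MeasurableSet (sector δ ξ) := by
  unfold sector
  measurability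

lemma mem_sector_of_le_inner {n : ℕ} {δ : ℝ} {ξ z : Rn n} (hz : z ≠ 0)
    (h : δ * ‖z‖ ≤ inner ℝ z ξ) : z ∈ sector δ ξ := by
  have hz' : 0 < ‖z‖ := norm_pos_iff.2 hz
  rw [sector, mem_ofPred_eq, real_inner_smul_left]
  refine le_trans ?_ (le_abs_self _)
  rw [inv_mul_eq_div, le_div_iff₀ hz']
  exact h

lemma ball_subset_ringSector {n : ℕ} {δ : ℝ} (hδ : δ ∈ Ioo (0 : ℝ) 1) {ξ : Rn n} (hξ : ‖ξ‖ = 1) :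
    ball ((3 / 4 : ℝ) • ξ) ((1 - δ) / 4) ⊆ ringSector δ ξ := by
  obtain ⟨h0, h1⟩ := hδ
  intro z hz
  obtain ⟨w, rfl⟩ : ∃ w, z = (3 / 4 : ℝ) • ξ + w := ⟨z - (3 / 4 : ℝ) • ξ, by abel⟩
  have hw : ‖w‖ < (1 - δ) / 4 := by simpa [mem_ball, dist_eq_norm] using hz
  have hξ' : ‖(3 / 4 : ℝ) • ξ‖ = 3 / 4 := by rw [norm_smul, hξ]; norm_num
  have hup := norm_add_le ((3 / 4 : ℝ) • ξ) w
  have hlo := norm_sub_le_norm_add ((3 / 4 : ℝ) • ξ) w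
  rw [hξ'] at hup hlo
  have hlo' : 1 / 2 < ‖(3 / 4 : ℝ) • ξ + w‖ := by linarith
  refine ⟨⟨by rw [mem_ball_zero_iff]; linarith, by rw [mem_ball_zero_iff]; linarith⟩, ?_⟩
  refine mem_sector_of_le_inner (norm_pos_iff.1 (by linarith)) ?_
  have hin : -‖w‖ ≤ inner ℝ w ξ := by
    have := abs_real_inner_le_norm w ξ
    rw [hξ, mul_one] at this
    exact (abs_le.1 this).1
  rw [inner_add_left, real_inner_smul_left, real_inner_self_eq_norm_sq, hξ]
  nlinarith

lemma volume_ringSector_lt_top {n : ℕ} (δ : ℝ) (ξ : Rn n) : volume (ringSector δ ξ) < ⊤ :=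
  (measure_mono (inter_subset_left.trans sdiff_subset)).trans_lt measure_ball_lt_top

/-- The inscribed ball has the same radius for all `ξ`, so the bound is uniform; this matters
because the direction given by the equation is uncontrolled. -/
lemma exists_volume_ringSector_ge (n : ℕ) {δ : ℝ} (hδ : δ ∈ Ioo (0 : ℝ) 1) :
    ∃ c : ℝ, 0 < c ∧ ∀ ξ : Rn n, ‖ξ‖ = 1 → ENNReal.ofReal c ≤ volume (ringSector δ ξ) := by
  have hpos : 0 < (1 - δ) / 4 := by linarith [hδ.2]
  refine ⟨(volume (ball (0 : Rn n) ((1 - δ) / 4))).toReal,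
    ENNReal.toReal_pos (measure_ball_pos _ _ hpos).ne' measure_ball_lt_top.ne, fun ξ hξ => ?_⟩
  rw [ENNReal.ofReal_toReal measure_ball_lt_top.ne]
  refine le_trans (le_of_eq ?_) (measure_mono (ball_subset_ringSector hδ hξ))
  rw [Measure.addHaar_ball_center _ ((3 / 4 : ℝ) • ξ)]

/-- A cap of the ring sector, cut off by a half space at small distance from the origin, contains
a ball of fixed radius. -/
lemma exists_ball_subset_ringSector_halfspace {n : ℕ} {δ : ℝ} (hδ : δ ∈ Ioo (0 : ℝ) 1)
    {ξ e : Rn n} (hξ : ‖ξ‖ = 1) (he : ‖e‖ = 1) :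
    ∃ w : Rn n, ball w ((1 - δ) / 16) ⊆
      {z ∈ ringSector δ ξ | (1 - δ) / 16 ≤ inner ℝ e z} := by
  -- The cone is double, so `ξ` may be reversed.
  wlog hs : 0 ≤ inner ℝ e ξ generalizing ξ
  · have := this (ξ := -ξ) (by simpa using hξ) (by rw [inner_neg_right]; linarith)
    rwa [ringSector_neg] at this
  have hpos : 0 < 1 - δ := by linarith [hδ.2]
  -- The shift along `e` gains height `(1 - δ) / 8`, of which the radius costs half; shift plus
  -- radius stays below the `(1 - δ) / 4` available around `(3 / 4) ξ`.
  refine ⟨(3 / 4 : ℝ) • ξ + ((1 - δ) / 8) • e, fun z hz => ?_⟩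
  obtain ⟨w, rfl⟩ : ∃ w, z = (3 / 4 : ℝ) • ξ + ((1 - δ) / 8) • e + w :=
    ⟨z - ((3 / 4 : ℝ) • ξ + ((1 - δ) / 8) • e), by abel⟩
  have hw : ‖w‖ < (1 - δ) / 16 := by simpa [mem_ball, dist_eq_norm] using hz
  refine ⟨ball_subset_ringSector hδ hξ ?_, ?_⟩
  · rw [mem_ball, dist_eq_norm, add_assoc, add_sub_cancel_left]
    have := norm_add_le (((1 - δ) / 8) • e) w
    rw [norm_smul, he, Real.norm_of_nonneg (by linarith)] at this
    linarith
  · have hin : -‖w‖ ≤ inner ℝ e w := by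
      have := abs_real_inner_le_norm e w
      rw [he, one_mul] at this
      exact (abs_le.1 this).1
    rw [inner_add_right, inner_add_right, real_inner_smul_right, real_inner_smul_right,
      real_inner_self_eq_norm_sq, he]
    linarith

/-- If `G` drops by more than `b` below the plane at some `y ∈ B_l`, then a convex superlevel set of
`G - p` omits `y`, hence misses a half space at distance less than `l` from `0`. That half space
cuts from the ring sector a cap of fixed volume on which the drop also exceeds `b`. -/
lemma exists_isSectorRadius (n : ℕ) {δ : ℝ} (hδ : δ ∈ Ioo (0 : ℝ) 1) :
    ∃ l : ℝ, IsSectorRadius n δ l := by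
  have hpos : 0 < (1 - δ) / 16 := by linarith [hδ.2]
  set v := volume (ball (0 : Rn n) ((1 - δ) / 16)) with hv
  set V := volume (ball (0 : Rn n) 1) with hV
  have hv0 : 0 < v.toReal := ENNReal.toReal_pos (measure_ball_pos _ _ hpos).ne'
    measure_ball_lt_top.ne
  have hV0 : 0 < V.toReal := ENNReal.toReal_pos (measure_ball_pos _ _ one_pos).ne'
    measure_ball_lt_top.ne
  refine ⟨(1 - δ) / 16, hpos, by linarith [hδ.1], v.toReal / (2 * V.toReal), by positivity, ?_⟩
  intro ξ hξ G hG p hp b hb hvol y hy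
  by_contra! hlt
  have hy1 : y ∈ ball (0 : Rn n) 1 := ball_subset_ball (by linarith [hδ.1]) hy
  set H : Rn n → ℝ := fun z => G z - inner ℝ p z with hH
  have hHc : ConcaveOn ℝ (ball 0 1) H :=
    hG.sub ((innerₛₗ ℝ p).convexOn (convex_ball 0 1))
  obtain ⟨b', hb1, hb2⟩ : ∃ b', H y < b' ∧ b' < G 0 - b :=
    exists_between (by simp only [hH]; linarith)
  have hconv : Convex ℝ {z ∈ ball (0 : Rn n) 1 | b' < H z} := hHc.convex_gt b'
  have hopen : IsOpen {z ∈ ball (0 : Rn n) 1 | b' < H z} :=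
    (hHc.continuousOn isOpen_ball).isOpen_inter_preimage isOpen_ball isOpen_Ioi
  obtain ⟨F, hF⟩ := geometric_hahn_banach_open_point hconv hopen (x := y)
    (fun h => absurd h.2 (by simpa using hb1.le))
  obtain ⟨a, rfl⟩ := (InnerProductSpace.toDual ℝ (Rn n)).surjective F
  simp only [InnerProductSpace.toDual_apply_apply] at hF
  have h0 : 0 < inner ℝ a y := by
    have := hF 0 ⟨by simp, by simp [hH]; linarith⟩
    simpa using this
  have ha : a ≠ 0 := by rintro rfl; simp at h0
  have ha' : 0 < ‖a‖ := norm_pos_iff.2 ha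
  have he : ‖‖a‖⁻¹ • a‖ = 1 := norm_smul_inv_norm (𝕜 := ℝ) ha
  obtain ⟨w, hw⟩ := exists_ball_subset_ringSector_halfspace hδ hξ he
  have hsub : ball w ((1 - δ) / 16) ⊆ {z ∈ ringSector δ ξ | G z < G 0 + inner ℝ p z - b} := by
    intro z hz
    obtain ⟨hz1, hz2⟩ := hw hz
    refine ⟨hz1, ?_⟩
    by_contra! hge
    have h1 := hF z ⟨hz1.1.1, by simp only [hH]; linarith⟩
    rw [real_inner_smul_left, inv_mul_eq_div, le_div_iff₀ ha'] at hz2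
    have h2 := real_inner_le_norm a y
    have h3 : ‖y‖ < (1 - δ) / 16 := by simpa using hy
    nlinarith
  have h1 : v ≤ ENNReal.ofReal (v.toReal / (2 * V.toReal)) * V := by
    calc v = volume (ball w ((1 - δ) / 16)) := (Measure.addHaar_ball_center _ _ _).symm
      _ ≤ _ := measure_mono hsub
      _ ≤ _ := hvol
      _ ≤ _ := mul_le_mul_right (measure_mono (inter_subset_left.trans sdiff_subset)) _
  rw [← ENNReal.ofReal_toReal (a := V) measure_ball_lt_top.ne, ← ENNReal.ofReal_mul (by positivity),
    ← ENNReal.ofReal_toReal (a := v) measure_ball_lt_top.ne,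
    ENNReal.ofReal_le_ofReal_iff (by positivity)] at h1
  simp only [ENNReal.toReal_ofReal ENNReal.toReal_nonneg] at h1
  field_simp at h1
  linarith

/-! ### Concave functions and the concave envelope -/

/-- Separate `(x, G x)` from the open convex strict hypograph. The hyperplane is not vertical,
because points just below `(x, G x)` lie in the hypograph. -/
lemma exists_superdiff {n : ℕ} {D : Set (Rn n)} (hD : IsOpen D) {G : Rn n → ℝ}
    (hG : ConcaveOn ℝ D G) {x : Rn n} (hx : x ∈ D) : (superdiff D G x).Nonempty := by
  have hconv : Convex ℝ {q : Rn n × ℝ | q.1 ∈ D ∧ q.2 < G q.1} := hG.convex_strict_hypograph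
  have hopen : IsOpen {q : Rn n × ℝ | q.1 ∈ D ∧ q.2 < G q.1} := by
    have hc : ContinuousOn (fun q : Rn n × ℝ => G q.1 - q.2) (D ×ˢ univ) :=
      ((hG.continuousOn hD).comp continuousOn_fst fun q hq => hq.1).sub continuousOn_snd
    convert hc.isOpen_inter_preimage (hD.prod isOpen_univ) (isOpen_Ioi (a := 0)) using 1
    ext q
    simp [sub_pos]
  obtain ⟨F, hF⟩ := geometric_hahn_banach_open_point hconv hopen (x := (x, G x))
    (fun h => lt_irrefl _ h.2)
  set g : Rn n →L[ℝ] ℝ := F.comp (ContinuousLinearMap.inl ℝ (Rn n) ℝ) with hg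
  set c : ℝ := F (0, 1) with hc
  have hsplit : ∀ (y : Rn n) (t : ℝ), F (y, t) = g y + t * c := by
    intro y t
    have : (y, t) = (y, (0 : ℝ)) + t • ((0 : Rn n), (1 : ℝ)) := by simp
    rw [this, map_add, map_smul]
    simp [hg, hc]
  have hc0 : 0 < c := by
    have := hF (x, G x - 1) ⟨hx, by simp⟩
    rw [hsplit, hsplit] at this
    linarith
  obtain ⟨a, ha⟩ := (InnerProductSpace.toDual ℝ (Rn n)).surjective g
  have ha' : ∀ y, g y = inner ℝ a y := fun y => by rw [← ha]; simp
  refine ⟨-(c⁻¹ • a), fun y hy => ?_⟩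
  have key : g y + G y * c ≤ g x + G x * c := by
    refine le_of_forall_pos_lt_add fun ε hε => ?_
    have := hF (y, G y - ε / c) ⟨hy, by have := div_pos hε hc0; simp only; linarith⟩
    rw [hsplit, hsplit, sub_mul, div_mul_cancel₀ _ hc0.ne'] at this
    linarith
  rw [ha', ha'] at key
  rw [inner_neg_left, real_inner_smul_left, inner_sub_right, inv_mul_eq_div, ← sub_eq_add_neg,
    le_sub_iff_add_le, ← le_sub_iff_add_le', div_le_iff₀ hc0]
  nlinarith

lemma smul_mem_superdiff_comp {n : ℕ} {D : Set (Rn n)} {G : Rn n → ℝ} {x p : Rn n} {r : ℝ}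
    (hp : p ∈ superdiff D G x) {D' : Set (Rn n)} (hD : ∀ z ∈ D', x + r • z ∈ D) :
    r • p ∈ superdiff D' (fun z => G (x + r • z)) 0 := by
  intro z hz
  have := hp _ (hD z hz)
  simpa [real_inner_smul_left, real_inner_smul_right] using this

section concaveEnv

variable {n : ℕ} {u : Rn n → ℝ} {B : ℝ}

lemma concaveEnv_of_mem {x : Rn n} (hx : x ∈ ball (0 : Rn n) 3) :
    concaveEnv u x = sInf {t : ℝ | ∃ (a : Rn n) (b : ℝ),
      (∀ y ∈ ball (0 : Rn n) 3, max (u y) 0 ≤ inner ℝ a y + b) ∧ t = inner ℝ a x + b} := by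
  rw [concaveEnv, if_pos hx]

lemma concaveEnv_le {x : Rn n} (hx : x ∈ ball (0 : Rn n) 3) {a : Rn n} {b : ℝ}
    (h : ∀ y ∈ ball (0 : Rn n) 3, max (u y) 0 ≤ inner ℝ a y + b) :
    concaveEnv u x ≤ inner ℝ a x + b := by
  rw [concaveEnv_of_mem hx]
  refine csInf_le ⟨max (u x) 0, ?_⟩ ⟨a, b, h, rfl⟩
  rintro _ ⟨a, b, h, rfl⟩
  exact h x hx

/-- The bound `B` supplies a constant majorant; without any majorant `sInf ∅ = 0` would be a junk
value. -/
lemma le_concaveEnv_of_forall (hB : ∀ y, u y ≤ B) {x : Rn n} (hx : x ∈ ball (0 : Rn n) 3) {t : ℝ}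
    (h : ∀ (a : Rn n) (b : ℝ), (∀ y ∈ ball (0 : Rn n) 3, max (u y) 0 ≤ inner ℝ a y + b) →
      t ≤ inner ℝ a x + b) : t ≤ concaveEnv u x := by
  rw [concaveEnv_of_mem hx]
  refine le_csInf ⟨_, 0, max B 0, fun y _ => ?_, rfl⟩ ?_
  · simpa using max_le_max (hB y) le_rfl
  · rintro _ ⟨a, b, hab, rfl⟩
    exact h a b hab

lemma max_le_concaveEnv (hB : ∀ y, u y ≤ B) {x : Rn n} (hx : x ∈ ball (0 : Rn n) 3) :
    max (u x) 0 ≤ concaveEnv u x :=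
  le_concaveEnv_of_forall hB hx fun _ _ h => h x hx

lemma concaveOn_concaveEnv (hB : ∀ y, u y ≤ B) :
    ConcaveOn ℝ (ball (0 : Rn n) 3) (concaveEnv u) := by
  refine ⟨convex_ball _ _, fun x hx y hy s t hs ht hst => ?_⟩
  refine le_concaveEnv_of_forall hB (convex_ball _ _ hx hy hs ht hst) fun a b h => ?_
  have h1 := mul_le_mul_of_nonneg_left (concaveEnv_le hx h) hs
  have h2 := mul_le_mul_of_nonneg_left (concaveEnv_le hy h) ht
  simp only [smul_eq_mul, inner_add_right, real_inner_smul_right]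
  calc _ ≤ s * (inner ℝ a x + b) + t * (inner ℝ a y + b) := add_le_add h1 h2
    _ = s * inner ℝ a x + t * inner ℝ a y + (s + t) * b := by ring
    _ = _ := by rw [hst, one_mul]

lemma measurable_concaveEnv (hB : ∀ y, u y ≤ B) : Measurable (concaveEnv u) := by
  classical
  have h : concaveEnv u = (ball (0 : Rn n) 3).piecewise (concaveEnv u) (fun _ => 0) := by
    ext x
    by_cases hx : x ∈ ball (0 : Rn n) 3
    · simp [hx]
    · rw [piecewise_eq_of_notMem _ _ _ hx, concaveEnv, if_neg hx]
  rw [h]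
  exact ContinuousOn.measurable_piecewise ((concaveOn_concaveEnv hB).continuousOn isOpen_ball)
    continuousOn_const measurableSet_ball

end concaveEnv

lemma exists_forall_le_of_isViscositySubsolution {n : ℕ} {δ lam Lam α : ℝ} {f u : Rn n → ℝ}
    (hu : IsViscositySubsolution δ lam Lam α (ball 0 1) f u)
    (hout : ∀ x ∉ ball (0 : Rn n) 1, u x ≤ 0) : ∃ B, ∀ y, u y ≤ B := by
  have h := hu.1
  rw [closure_ball _ one_ne_zero] at h
  obtain ⟨B, hB⟩ := h.bddAbove_of_isCompact (isCompact_closedBall _ _)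
  refine ⟨max B 0, fun y => ?_⟩
  by_cases hy : y ∈ ball (0 : Rn n) 1
  · exact le_max_of_le_left (hB ⟨y, ball_subset_closedBall hy, rfl⟩)
  · exact le_max_of_le_right (hout y hy)

/-! ### The equation at contact points -/

section Contact

variable {n : ℕ} {δ lam Lam α B : ℝ} {f u : Rn n → ℝ} {x p : Rn n}

lemma mem_ball_of_mem_contactSet (hx : x ∈ contactSet u) : x ∈ ball (0 : Rn n) 1 := hx.2

lemma add_mem_ball_three (hx : x ∈ contactSet u) {h : Rn n} (hh : ‖h‖ < 2) :
    x + h ∈ ball (0 : Rn n) 3 := by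
  have h1 : ‖x‖ < 1 := by simpa using hx.2
  rw [mem_ball_zero_iff]
  linarith [norm_add_le x h]

lemma le_of_mem_superdiff (hB : ∀ y, u y ≤ B) (hx : x ∈ contactSet u)
    (hp : p ∈ superdiff (ball 0 3) (concaveEnv u) x) {h : Rn n} (hh : ‖h‖ < 2) :
    u (x + h) ≤ u x + inner ℝ p h := by
  have h1 := hp _ (add_mem_ball_three hx hh)
  have h2 := (le_max_left _ _).trans (max_le_concaveEnv hB (add_mem_ball_three hx hh))
  rw [add_sub_cancel_left, ← show u x = concaveEnv u x from hx.1] at h1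
  exact h2.trans h1

lemma nonneg_of_mem_contactSet (hB : ∀ y, u y ≤ B) (hx : x ∈ contactSet u) : 0 ≤ u x := by
  rw [show u x = concaveEnv u x from hx.1]
  exact (le_max_right _ _).trans (max_le_concaveEnv hB (ball_subset_ball (by norm_num) hx.2))

/-- For `‖h‖ < 2` the linear terms of the supporting plane cancel; for `‖h‖ ≥ 2` both `x ± h` lie
outside `B₁`, where `u ≤ 0 ≤ u x`. -/
lemma secondDiff_nonpos_of_mem_contactSet (hB : ∀ y, u y ≤ B)
    (hout : ∀ x ∉ ball (0 : Rn n) 1, u x ≤ 0) (hx : x ∈ contactSet u)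
    (hp : p ∈ superdiff (ball 0 3) (concaveEnv u) x) (h : Rn n) : secondDiff u x h ≤ 0 := by
  rcases lt_or_ge ‖h‖ 2 with hh | hh
  · have h1 := le_of_mem_superdiff hB hx hp hh
    have h2 := le_of_mem_superdiff hB hx hp (h := -h) (by simpa using hh)
    rw [inner_neg_right, ← sub_eq_add_neg] at h2
    rw [secondDiff]
    linarith
  · have hx1 : ‖x‖ < 1 := by simpa using hx.2
    have h0 := nonneg_of_mem_contactSet hB hx
    have h1 := hout (x + h) (by
      rw [mem_ball_zero_iff, not_lt]
      have := norm_sub_le_norm_add h x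
      rw [add_comm x h]
      linarith)
    have h2 := hout (x - h) (by
      rw [mem_ball_zero_iff, not_lt, norm_sub_rev]
      linarith [norm_sub_norm_le h x])
    rw [secondDiff]
    linarith

/-- Since `2n + 4 ≥ n + α`, the perturbation of the test function absorbs the kernel's singularity.
-/
lemma kernel_mul_pow_le (hα : α ∈ Ioo (0 : ℝ) 2) (hLam : 0 < Lam) {ε : ℝ} (hε : 0 < ε) {h : Rn n}
    (h0 : h ≠ 0) (h1 : ‖h‖ < 1) :
    2 * ε * (‖h‖ ^ 2) ^ (n + 2) * (Lam * (2 - α) / ‖h‖ ^ ((n : ℝ) + α)) ≤ 4 * ε * Lam := by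
  have hn : 0 < ‖h‖ := norm_pos_iff.2 h0
  have hpow : (‖h‖ ^ 2) ^ (n + 2) ≤ ‖h‖ ^ ((n : ℝ) + α) := by
    rw [← pow_mul, ← Real.rpow_natCast]
    refine Real.rpow_le_rpow_of_exponent_ge hn h1.le ?_
    push_cast
    nlinarith [hα.1, hα.2, (Nat.cast_nonneg n : (0 : ℝ) ≤ n)]
  have hd : 0 < ‖h‖ ^ ((n : ℝ) + α) := Real.rpow_pos_of_pos hn _
  have h2 : 0 < 2 - α := by linarith [hα.2]
  rw [mul_div_assoc', div_le_iff₀ hd]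
  calc 2 * ε * (‖h‖ ^ 2) ^ (n + 2) * (Lam * (2 - α))
      ≤ 2 * ε * ‖h‖ ^ ((n : ℝ) + α) * (Lam * 2) := by
        gcongr
        linarith [hα.1]
    _ = _ := by ring

lemma exists_setLIntegral_secondDiff_le (hlam : 0 < lam) (hLam : lam ≤ Lam)
    (hα : α ∈ Ioo (0 : ℝ) 2)
    (hu : IsViscositySubsolution δ lam Lam α (ball 0 1) f u) (hB : ∀ y, u y ≤ B)
    (hout : ∀ x ∉ ball (0 : Rn n) 1, u x ≤ 0) (hx : x ∈ contactSet u)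
    (hp : p ∈ superdiff (ball 0 3) (concaveEnv u) x) {e r : ℝ} (he : 0 < e) (hr : 0 < r) :
    ∃ ξ : Rn n, ‖ξ‖ = 1 ∧
      ∫⁻ h in sector δ ξ \ ball 0 r, ENNReal.ofReal (-secondDiff u x h) *
        ENNReal.ofReal (lam * (2 - α) / ‖h‖ ^ ((n : ℝ) + α)) ≤ ENNReal.ofReal (f x + e) := by
  classical
  have hx1 : ‖x‖ < 1 := by simpa using hx.2
  have hLam0 : 0 < Lam := hlam.trans_le hLam
  have h2α : 0 < 2 - α := by linarith [hα.2]
  -- This keeps `N` inside `B₁` and makes the modified function have the second differences of `u`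
  -- outside `ball 0 r`.
  set r' := min r (1 - ‖x‖) with hr'
  have hr'0 : 0 < r' := lt_min hr (by linarith)
  have hr'r : r' ≤ r := min_le_left _ _
  have hr'1 : r' ≤ 1 - ‖x‖ := min_le_right _ _
  set V := (volume (ball (0 : Rn n) 1)).toReal with hV
  have hV0 : 0 ≤ V := ENNReal.toReal_nonneg
  set ε := e / (8 * Lam * (V + 1)) with hε
  have hε0 : 0 < ε := by positivity
  set N := ball x r' with hN
  have hN1 : N ⊆ ball 0 1 := by
    intro y hy
    rw [hN, mem_ball, dist_eq_norm] at hy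
    rw [mem_ball_zero_iff]
    have := norm_add_le x (y - x)
    rw [add_sub_cancel] at this
    linarith
  set φ : Rn n → ℝ := fun y => u x + inner ℝ p (y - x) + ε * (‖y - x‖ ^ 2) ^ (n + 2) with hφ
  have hφc : ContDiff ℝ 2 φ := by
    have h1 : ContDiff ℝ 2 fun y : Rn n => y - x := contDiff_id.sub contDiff_const
    exact (contDiff_const.add (contDiff_const.inner ℝ h1)).add
      (contDiff_const.mul ((h1.norm_sq ℝ).pow _))
  have hφx : φ x = u x := by simp [hφ]
  have htouch : ∀ y ∈ N, y ≠ x → u y < φ y := by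
    intro y hy hyx
    rw [hN, mem_ball, dist_eq_norm] at hy
    have h1 := le_of_mem_superdiff hB hx hp (h := y - x)
      (by linarith [norm_nonneg x])
    rw [add_sub_cancel] at h1
    have h2 : 0 < ‖y - x‖ := norm_pos_iff.2 (sub_ne_zero.2 hyx)
    have h3 : 0 < ε * (‖y - x‖ ^ 2) ^ (n + 2) := by positivity
    simp only [hφ]
    linarith
  have hop := hu.2 x hx.2 N isOpen_ball (mem_ball_self hr'0) hN1 φ hφc hφx htouch
  set v : Rn n → ℝ := fun y => if y ∈ N then φ y else u y with hv
  have hvx : v x = u x := by simp [hv, hN, hr'0, hφx]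
  have hvin : ∀ h : Rn n, ‖h‖ < r' → secondDiff v x h = 2 * ε * (‖h‖ ^ 2) ^ (n + 2) := by
    intro h hh
    have h1 : v (x + h) = φ (x + h) := by simp [hv, hN, hh]
    have h2 : v (x - h) = φ (x - h) := by simp [hv, hN, hh, dist_eq_norm]
    rw [secondDiff, hvx, h1, h2]
    simp only [hφ, add_sub_cancel_left, sub_sub_cancel_left, inner_neg_right, norm_neg]
    ring
  have hvout : ∀ h : Rn n, r' ≤ ‖h‖ → secondDiff v x h = secondDiff u x h := by
    intro h hh
    have h1 : v (x + h) = u (x + h) := by simp [hv, hN, hh]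
    have h2 : v (x - h) = u (x - h) := by simp [hv, hN, hh, dist_eq_norm]
    rw [secondDiff, secondDiff, hvx, h1, h2]
  -- The supremum need not be attained: half of `e` pays for the choice of a kernel, the other half
  -- for the perturbation.
  have hlt : ((-(f x + e / 2) : ℝ) : EReal) < maxOp δ lam Lam α v x :=
    lt_of_lt_of_le (EReal.coe_lt_coe_iff.2 (by linarith)) hop
  rw [maxOp, lt_iSup_iff] at hlt
  obtain ⟨K, hlt⟩ := hlt
  rw [lt_iSup_iff] at hlt
  obtain ⟨⟨-, -, ξ, hξ, hKξ⟩, hlt⟩ := hlt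
  refine ⟨ξ, hξ, ?_⟩
  rw [nonlocalOp] at hlt
  set P := ∫⁻ h, ENNReal.ofReal (secondDiff v x h) * ENNReal.ofReal (K h) with hP
  set Q := ∫⁻ h, ENNReal.ofReal (-secondDiff v x h) * ENNReal.ofReal (K h) with hQ
  have hPle : P ≤ ENNReal.ofReal (e / 2) := by
    calc P ≤ ∫⁻ h, (ball (0 : Rn n) 1).indicator (fun _ => ENNReal.ofReal (4 * ε * Lam)) h := by
          refine lintegral_mono fun h => ?_
          rcases lt_or_ge ‖h‖ r' with hh | hh
          · have hh1 : ‖h‖ < 1 := by linarith [norm_nonneg x]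
            rw [indicator_of_mem (by simpa using hh1)]
            rcases eq_or_ne h 0 with rfl | h0
            · simp [hvin 0 (by simpa using hr'0)]
            · rw [hvin h hh, ← ENNReal.ofReal_mul (by positivity)]
              refine ENNReal.ofReal_le_ofReal (le_trans ?_ (kernel_mul_pow_le hα hLam0 hε0 h0 hh1))
              exact mul_le_mul_of_nonneg_left (hKξ h h0).2 (by positivity)
          · rw [hvout h hh, ENNReal.ofReal_of_nonpos
              (secondDiff_nonpos_of_mem_contactSet hB hout hx hp h), zero_mul]
            exact zero_le
      _ = ENNReal.ofReal (4 * ε * Lam) * volume (ball (0 : Rn n) 1) := by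
          rw [lintegral_indicator measurableSet_ball, setLIntegral_const]
      _ = ENNReal.ofReal (4 * ε * Lam * V) := by
          rw [← ENNReal.ofReal_toReal (a := volume (ball (0 : Rn n) 1)) measure_ball_lt_top.ne,
            ← ENNReal.ofReal_mul (by positivity)]
      _ ≤ _ := by
          refine ENNReal.ofReal_le_ofReal ?_
          rw [hε]
          field_simp
          nlinarith
  have hQle : Q ≤ ENNReal.ofReal (f x + e) := by
    by_contra! hlt'
    refine absurd hlt (not_lt.2 ?_)
    have h1 : (P : EReal) ≤ ((e / 2 : ℝ) : EReal) := by
      refine (EReal.coe_ennreal_le_coe_ennreal_iff.2 hPle).trans_eq ?_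
      rw [EReal.coe_ennreal_ofReal, max_eq_left (by linarith)]
    have h2 : ((f x + e : ℝ) : EReal) ≤ Q := by
      refine le_trans ?_ (EReal.coe_ennreal_le_coe_ennreal_iff.2 hlt'.le)
      rw [EReal.coe_ennreal_ofReal]
      exact EReal.coe_le_coe_iff.2 (le_max_left _ _)
    refine (EReal.sub_le_sub h1 h2).trans_eq ?_
    rw [← EReal.coe_sub]
    congr 1
    ring
  refine le_trans ?_ hQle
  refine le_trans (setLIntegral_mono' ((measurableSet_sector δ ξ).diff measurableSet_ball) ?_)
    (setLIntegral_le_lintegral _ _)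
  rintro h ⟨hh1, hh2⟩
  rw [mem_ball_zero_iff, not_lt] at hh2
  rw [hvout h (hr'r.trans hh2)]
  have h0 : h ≠ 0 := norm_pos_iff.1 (hr.trans_le hh2)
  have := (hKξ h h0).1
  rw [indicator_of_mem hh1] at this
  gcongr

end Contact

/-! ### The sum over dyadic rings -/

/-- The dyadic scales `t 2^{-1/(2-α)} 2^{-k}`. -/
noncomputable def dyadicScale (α t : ℝ) (k : ℕ) : ℝ := t * (2 : ℝ) ^ (-1 / (2 - α)) / 2 ^ k

section dyadicScale

variable {α t : ℝ}

lemma dyadicScale_pos (ht : 0 < t) (k : ℕ) : 0 < dyadicScale α t k := by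
  rw [dyadicScale]; positivity

lemma dyadicScale_succ (k : ℕ) : dyadicScale α t (k + 1) = dyadicScale α t k / 2 := by
  rw [dyadicScale, dyadicScale, pow_succ]
  field_simp

lemma dyadicScale_antitone (ht : 0 < t) : Antitone (dyadicScale α t) :=
  antitone_nat_of_succ_le fun k => by
    rw [dyadicScale_succ]; linarith [dyadicScale_pos (α := α) ht k]

lemma dyadicScale_le (hα : α < 2) (ht : 0 < t) (k : ℕ) : dyadicScale α t k ≤ t := by
  refine (dyadicScale_antitone ht (zero_le (a := k))).trans ?_
  have : (2 : ℝ) ^ (-1 / (2 - α)) ≤ 1 :=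
    Real.rpow_le_one_of_one_le_of_nonpos (by norm_num)
      (div_nonpos_of_nonpos_of_nonneg (by norm_num) (by linarith))
  rw [dyadicScale, pow_zero, div_one]
  nlinarith

lemma dyadicScale_rpow (hα : α < 2) (ht : 0 < t) (k : ℕ) :
    dyadicScale α t k ^ (2 - α) = t ^ (2 - α) / 2 * ((2 : ℝ) ^ (-(2 - α))) ^ k := by
  have h : 2 - α ≠ 0 := by linarith
  rw [dyadicScale, Real.div_rpow (by positivity) (by positivity),
    Real.mul_rpow ht.le (by positivity), ← Real.rpow_mul (by norm_num), div_mul_cancel₀ _ h,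
    Real.rpow_neg_one, Real.rpow_neg (by norm_num), inv_pow, ← Real.rpow_natCast,
    ← Real.rpow_natCast, ← Real.rpow_mul (by norm_num), ← Real.rpow_mul (by norm_num),
    mul_comm (k : ℝ)]
  ring

/-- The geometric ratio `q = 2^(-(2-α))` satisfies `1 - q ≤ 2 - α`, so the prefactor `2 - α`
compensates `1 / (1 - q)` or better, and `K` terms give at least half of the full series. The bound
is free of `α`. -/
lemma le_sum_dyadicScale_rpow (hα : α ∈ Ioo (0 : ℝ) 2) (ht : 0 < t) (ht1 : t ≤ 1) {K : ℕ}
    (hK : ((2 : ℝ) ^ (-(2 - α))) ^ K ≤ 1 / 2) :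
    t ^ 2 / 4 ≤ (2 - α) * ∑ k ∈ Finset.range K, dyadicScale α t k ^ (2 - α) := by
  obtain ⟨h0, h2⟩ := hα
  have ha : 0 < 2 - α := by linarith
  set q := (2 : ℝ) ^ (-(2 - α)) with hq
  have hq1 : q < 1 := Real.rpow_lt_one_of_one_lt_of_neg (by norm_num) (by linarith)
  have hq2 : 1 - q ≤ 2 - α := by
    have h1 := Real.add_one_le_exp (Real.log 2 * -(2 - α))
    rw [← Real.rpow_def_of_pos (by norm_num), ← hq] at h1
    have h3 : Real.log 2 < 1 := by linarith [Real.log_two_lt_d9]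
    nlinarith
  have ht2 : t ^ 2 ≤ t ^ (2 - α) := by
    rw [← Real.rpow_natCast]
    exact Real.rpow_le_rpow_of_exponent_ge ht ht1 (by push_cast; linarith)
  have hsum : ∑ k ∈ Finset.range K, dyadicScale α t k ^ (2 - α) =
      t ^ (2 - α) / 2 * ((1 - q ^ K) / (1 - q)) := by
    rw [Finset.sum_congr rfl fun k _ => dyadicScale_rpow h2 ht k, ← Finset.mul_sum,
      geom_sum_eq hq1.ne, ← neg_div_neg_eq (q ^ K - 1), neg_sub, neg_sub]
  have hquot : 1 / 2 ≤ (2 - α) * ((1 - q ^ K) / (1 - q)) := by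
    rw [mul_div_assoc', le_div_iff₀ (by linarith)]
    nlinarith
  rw [hsum]
  calc t ^ 2 / 4 = t ^ 2 / 2 * (1 / 2) := by ring
    _ ≤ t ^ (2 - α) / 2 * ((2 - α) * ((1 - q ^ K) / (1 - q))) := by gcongr
    _ = _ := by ring

lemma exists_pow_rpow_neg_le_half (hα : α < 2) :
    ∃ K : ℕ, ((2 : ℝ) ^ (-(2 - α))) ^ K ≤ 1 / 2 := by
  obtain ⟨K, hK⟩ := exists_pow_lt_of_lt_one (by norm_num : (0 : ℝ) < 1 / 2)
    (Real.rpow_lt_one_of_one_lt_of_neg (by norm_num : (1 : ℝ) < 2) (by linarith : -(2 - α) < 0))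
  exact ⟨K, hK.le⟩

end dyadicScale

section Ring

variable {n : ℕ} {δ lam Lam α B : ℝ} {f u : Rn n → ℝ} {x p : Rn n}

/-- The part of the ring sector of radius `r` at `x` where `u` is more than `b` below the plane. -/
def badSet (δ : ℝ) (u : Rn n → ℝ) (x p ξ : Rn n) (r b : ℝ) : Set (Rn n) :=
  {z ∈ ringSector δ ξ | u (x + r • z) < u x + r * inner ℝ p z - b}

lemma aemeasurable_comp_add (hu : AEMeasurable u volume) (x : Rn n) :
    AEMeasurable (fun h => u (x + h)) volume :=
  hu.comp_quasiMeasurePreserving (measurePreserving_add_left volume x).quasiMeasurePreserving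

/-- The contribution of a ring to the integral of the second difference. -/
lemma le_setLIntegral_secondDiff (hlam : 0 < lam) (hα : α ∈ Ioo (0 : ℝ) 2)
    (hum : AEMeasurable u volume) (hB : ∀ y, u y ≤ B) (hx : x ∈ contactSet u)
    (hp : p ∈ superdiff (ball 0 3) (concaveEnv u) x) {ξ : Rn n} {r b : ℝ} (hr : 0 < r)
    (hr1 : r ≤ 1) (hb : 0 ≤ b) :
    ENNReal.ofReal (b * (lam * (2 - α) / r ^ ((n : ℝ) + α)) * r ^ n) *
        volume (badSet δ u x p ξ r b) ≤
      ∫⁻ h in sector δ ξ ∩ (ball 0 r \ ball 0 (r / 2)), ENNReal.ofReal (-secondDiff u x h) *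
        ENNReal.ofReal (lam * (2 - α) / ‖h‖ ^ ((n : ℝ) + α)) := by
  have h2α : 0 < 2 - α := by linarith [hα.2]
  set W : Set (Rn n) := (sector δ ξ ∩ (ball 0 r \ ball 0 (r / 2))) ∩
    {h | u (x + h) < u x + inner ℝ p h - b} with hW
  have hWm : NullMeasurableSet W volume := by
    refine ((measurableSet_sector δ ξ).inter
      (measurableSet_ball.diff measurableSet_ball)).nullMeasurableSet.inter ?_
    refine nullMeasurableSet_lt (aemeasurable_comp_add hum x) ?_
    fun_prop
  have hpre : badSet δ u x p ξ r b = (fun z : Rn n => r • z) ⁻¹' W := by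
    ext z
    have hn : ‖r • z‖ = r * ‖z‖ := by rw [norm_smul, Real.norm_of_nonneg hr.le]
    have e1 : r * ‖z‖ < r ↔ ‖z‖ < 1 := by
      constructor <;> intro h <;> nlinarith
    have e2 : r * ‖z‖ < r / 2 ↔ ‖z‖ < 1 / 2 := by
      constructor <;> intro h <;> nlinarith
    simp only [badSet, hW, ringSector, mem_ofPred_eq, mem_inter_iff, mem_sdiff, mem_preimage,
      mem_ball_zero_iff, smul_mem_sector hr, hn, real_inner_smul_right, e1, e2]
    tauto
  have hvol : volume (badSet δ u x p ξ r b) = ENNReal.ofReal (r ^ n)⁻¹ * volume W := by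
    rw [hpre, Measure.addHaar_preimage_smul _ hr.ne', finrank_euclideanSpace_fin,
      abs_of_pos (by positivity)]
  have hc : ENNReal.ofReal (b * (lam * (2 - α) / r ^ ((n : ℝ) + α)) * r ^ n) *
      volume (badSet δ u x p ξ r b) =
      ENNReal.ofReal (b * (lam * (2 - α) / r ^ ((n : ℝ) + α))) * volume W := by
    rw [hvol, ← mul_assoc, ← ENNReal.ofReal_mul (by positivity)]
    congr 2
    field_simp
  rw [hc, ← setLIntegral_const]
  refine le_trans ?_ (lintegral_mono_set (inter_subset_left (t := {h | u (x + h) <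
    u x + inner ℝ p h - b})))
  refine lintegral_mono_ae ?_
  filter_upwards [ae_restrict_mem₀ hWm] with h hh
  obtain ⟨⟨-, h1, h2⟩, h3⟩ := hh
  rw [mem_ball_zero_iff] at h1
  rw [mem_ball_zero_iff, not_lt] at h2
  have hpos : 0 < ‖h‖ := lt_of_lt_of_le (by linarith) h2
  rw [← ENNReal.ofReal_mul' (by positivity)]
  refine ENNReal.ofReal_le_ofReal ?_
  -- A deficit on one side is enough: at `x - h` the plane still bounds `u` from above.
  have hs : b ≤ -secondDiff u x h := by
    have h4 := le_of_mem_superdiff hB hx hp (h := -h) (by rw [norm_neg]; linarith)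
    rw [inner_neg_right, ← sub_eq_add_neg] at h4
    rw [mem_ofPred_eq] at h3
    rw [secondDiff]
    linarith
  have hpow : ‖h‖ ^ ((n : ℝ) + α) ≤ r ^ ((n : ℝ) + α) :=
    Real.rpow_le_rpow hpos.le h1.le (by linarith [hα.1, (Nat.cast_nonneg n : (0 : ℝ) ≤ n)])
  have hpow0 : 0 < ‖h‖ ^ ((n : ℝ) + α) := Real.rpow_pos_of_pos hpos _
  gcongr
  exact hb.trans hs

lemma pairwiseDisjoint_dyadic_rings {t : ℝ} (ht : 0 < t) (S : Set (Rn n)) :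
    Pairwise (Function.onFun Disjoint fun k : ℕ =>
      S ∩ (ball (0 : Rn n) (dyadicScale α t k) \ ball 0 (dyadicScale α t k / 2))) := by
  refine (pairwise_disjoint_on _).2 fun i j hij => ?_
  refine Set.disjoint_left.2 fun h hi hj => hi.2.2 ?_
  rw [← dyadicScale_succ]
  exact ball_subset_ball (dyadicScale_antitone ht hij) hj.2.1

/-- At a contact point, for one of finitely many dyadic scales, `u` is close to the supporting plane
in most of the ring sector. -/
lemma exists_volume_badSet_le (hlam : 0 < lam) (hLam : lam ≤ Lam) (hα : α ∈ Ioo (0 : ℝ) 2)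
    (hu : IsViscositySubsolution δ lam Lam α (ball 0 1) f u) (hum : AEMeasurable u volume)
    (hB : ∀ y, u y ≤ B) (hout : ∀ x ∉ ball (0 : Rn n) 1, u x ≤ 0) (hx : x ∈ contactSet u)
    (hf : 0 ≤ f x) (hp : p ∈ superdiff (ball 0 3) (concaveEnv u) x)
    {t c ε M e : ℝ} (ht : 0 < t) (ht1 : t ≤ 1) {K : ℕ}
    (hK : ((2 : ℝ) ^ (-(2 - α))) ^ K ≤ 1 / 2) (hc : 0 < c)
    (hcR : ∀ ξ : Rn n, ‖ξ‖ = 1 → ENNReal.ofReal c ≤ volume (ringSector δ ξ)) (hε : 0 < ε)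
    (hM : 0 < M) (hMlarge : 2 ≤ M * lam * ε * c * (t ^ 2 / 4)) (he : 0 < e) :
    ∃ k < K, ∃ ξ : Rn n, ‖ξ‖ = 1 ∧
      volume (badSet δ u x p ξ (dyadicScale α t k) (M * (f x + e) * dyadicScale α t k ^ 2)) ≤
        ENNReal.ofReal ε * volume (ringSector δ ξ) := by
  have h2α : 0 < 2 - α := by linarith [hα.2]
  -- With inner radius `r K`, all rings with `k < K` lie in the domain of integration, so one `ξ`
  -- serves them all.
  obtain ⟨ξ, hξ, hint⟩ := exists_setLIntegral_secondDiff_le hlam hLam hα hu hB hout hx hp he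
    (dyadicScale_pos (α := α) ht K)
  by_contra! hbad
  set r := dyadicScale α t with hr
  have hr0 : ∀ k, 0 < r k := dyadicScale_pos ht
  set g : Rn n → ENNReal := fun h => ENNReal.ofReal (-secondDiff u x h) *
    ENNReal.ofReal (lam * (2 - α) / ‖h‖ ^ ((n : ℝ) + α)) with hg
  set A : ℕ → Set (Rn n) := fun k => sector δ ξ ∩ (ball 0 (r k) \ ball 0 (r k / 2)) with hA
  have hAm : ∀ k ∈ Finset.range K, MeasurableSet (A k) := fun k _ =>
    (measurableSet_sector δ ξ).inter (measurableSet_ball.diff measurableSet_ball)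
  have hsub : ⋃ k ∈ Finset.range K, A k ⊆ sector δ ξ \ ball 0 (r K) := by
    refine iUnion₂_subset fun k hk h hh => ⟨hh.1, fun hmem => hh.2.2 ?_⟩
    rw [hr, ← dyadicScale_succ]
    exact ball_subset_ball (dyadicScale_antitone ht (Finset.mem_range.1 hk)) hmem
  have hring : ∀ k ∈ Finset.range K,
      ENNReal.ofReal (M * (f x + e) * lam * ε * c * (2 - α) * r k ^ (2 - α)) ≤
        ∫⁻ h in A k, g h := by
    intro k hk
    refine le_trans ?_ (le_setLIntegral_secondDiff hlam hα hum hB hx hp (hr0 k)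
      ((dyadicScale_le hα.2 ht k).trans ht1) (b := M * (f x + e) * r k ^ 2) (by positivity))
    have h1 : ENNReal.ofReal (ε * c) ≤
        volume (badSet δ u x p ξ (r k) (M * (f x + e) * r k ^ 2)) := by
      refine le_trans ?_ (hbad k (Finset.mem_range.1 hk) ξ hξ).le
      rw [ENNReal.ofReal_mul hε.le]
      exact mul_le_mul_right (hcR ξ hξ) _
    refine le_trans (le_of_eq ?_) (mul_le_mul_right h1 _)
    have hrk := hr0 k
    rw [← ENNReal.ofReal_mul (by positivity), Real.rpow_sub hrk, Real.rpow_add hrk,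
      Real.rpow_natCast, Real.rpow_ofNat]
    congr 1
    field_simp
  have hsum := le_sum_dyadicScale_rpow hα ht ht1 hK
  -- This is absurd because `f x + e > 0`; here `e > 0` is essential when `f x = 0`.
  have hfinal : ENNReal.ofReal (2 * (f x + e)) ≤ ENNReal.ofReal (f x + e) := by
    calc ENNReal.ofReal (2 * (f x + e))
        ≤ ENNReal.ofReal (∑ k ∈ Finset.range K,
            M * (f x + e) * lam * ε * c * (2 - α) * r k ^ (2 - α)) := by
          refine ENNReal.ofReal_le_ofReal ?_
          rw [← Finset.mul_sum]
          calc 2 * (f x + e) ≤ M * lam * ε * c * (t ^ 2 / 4) * (f x + e) := by gcongr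
            _ ≤ M * lam * ε * c * ((2 - α) * ∑ k ∈ Finset.range K, r k ^ (2 - α)) * (f x + e) := by
              gcongr
            _ = _ := by ring
      _ = ∑ k ∈ Finset.range K,
            ENNReal.ofReal (M * (f x + e) * lam * ε * c * (2 - α) * r k ^ (2 - α)) :=
          ENNReal.ofReal_sum_of_nonneg fun k _ => by have := hr0 k; positivity
      _ ≤ ∑ k ∈ Finset.range K, ∫⁻ h in A k, g h := Finset.sum_le_sum hring
      _ = ∫⁻ h in ⋃ k ∈ Finset.range K, A k, g h := (lintegral_biUnion_finset
          ((pairwiseDisjoint_dyadic_rings ht _).set_pairwise _) hAm g).symm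
      _ ≤ ∫⁻ h in sector δ ξ \ ball 0 (r K), g h := lintegral_mono_set hsub
      _ ≤ _ := hint
  rw [ENNReal.ofReal_le_ofReal_iff (by positivity)] at hfinal
  linarith

end Ring

/-! ### Flatness of the envelope at a good scale -/

section Flat

variable {n : ℕ} {δ B l : ℝ} {u : Rn n → ℝ} {x p : Rn n}

/-- As `Γ ≥ u`, with equality at `x`, wherever `Γ` is far below the plane so is `u`. The property of
`l` then applies to `z ↦ Γ (x + r z)`. -/
lemma le_concaveEnv_of_volume_badSet_le {ε₀ : ℝ}
    (hl : ∀ ξ : Rn n, ‖ξ‖ = 1 →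
      ∀ G : Rn n → ℝ, ConcaveOn ℝ (ball 0 1) G →
      ∀ p ∈ superdiff (ball 0 1) G 0, ∀ b : ℝ, 0 < b →
        volume {z ∈ ringSector δ ξ | G z < G 0 + inner ℝ p z - b} ≤
          ENNReal.ofReal ε₀ * volume (ringSector δ ξ) →
        ∀ y ∈ ball (0 : Rn n) l, G 0 + inner ℝ p y - b ≤ G y)
    (hB : ∀ y, u y ≤ B) (hx : x ∈ contactSet u)
    (hp : p ∈ superdiff (ball 0 3) (concaveEnv u) x) {ξ : Rn n} (hξ : ‖ξ‖ = 1) {r b : ℝ}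
    (hr : 0 < r) (hr1 : r ≤ 1) (hb : 0 < b)
    (hbad : volume (badSet δ u x p ξ r b) ≤ ENNReal.ofReal ε₀ * volume (ringSector δ ξ)) :
    ∀ y ∈ ball x (l * r), concaveEnv u x + inner ℝ p (y - x) - b ≤ concaveEnv u y := by
  have hmem : ∀ z ∈ ball (0 : Rn n) 1, x + r • z ∈ ball (0 : Rn n) 3 := by
    intro z hz
    rw [mem_ball_zero_iff] at hz
    refine add_mem_ball_three hx ?_
    rw [norm_smul, Real.norm_of_nonneg hr.le]
    nlinarith [norm_nonneg z]
  have hG : ConcaveOn ℝ (ball 0 1) fun z => concaveEnv u (x + r • z) := by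
    have h1 := (concaveOn_concaveEnv hB).comp_affineMap
      ((AffineMap.const ℝ (Rn n) x) + (r • (LinearMap.id : Rn n →ₗ[ℝ] Rn n)).toAffineMap)
    refine (h1.subset (fun z hz => ?_) (convex_ball _ _))
    simpa using hmem z hz
  have hmain := hl ξ hξ _ hG _ (smul_mem_superdiff_comp hp hmem) b hb (by
    refine (measure_mono ?_).trans hbad
    rintro z ⟨hz1, hz2⟩
    refine ⟨hz1, ?_⟩
    have h1 := (le_max_left _ _).trans (max_le_concaveEnv hB (hmem z hz1.1.1))
    rw [smul_zero, add_zero, ← show u x = concaveEnv u x from hx.1, real_inner_smul_left] at hz2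
    exact h1.trans_lt hz2)
  intro y hy
  have h := hmain (r⁻¹ • (y - x)) (by
    rw [mem_ball, dist_eq_norm] at hy
    rwa [mem_ball_zero_iff, norm_smul, norm_inv, Real.norm_of_nonneg hr.le, inv_mul_lt_iff₀ hr,
      mul_comm])
  simpa [real_inner_smul_left, real_inner_smul_right, hr.ne'] using h

/-- Off the bad set `u` is within `b` of the plane, which lies above `Γ`; as `ε ≤ 1 / 2`, at least
half of the ring sector remains. -/
lemma le_volume_near_concaveEnv {c ε : ℝ} (hε1 : ε ≤ 1 / 2)
    (hcR : ∀ ξ : Rn n, ‖ξ‖ = 1 → ENNReal.ofReal c ≤ volume (ringSector δ ξ))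
    (hx : x ∈ contactSet u)
    (hp : p ∈ superdiff (ball 0 3) (concaveEnv u) x) {ξ : Rn n} (hξ : ‖ξ‖ = 1) {r b : ℝ}
    (hr : 0 < r) (hr1 : r ≤ 1) (hbad : volume (badSet δ u x p ξ r b) ≤
      ENNReal.ofReal ε * volume (ringSector δ ξ)) :
    ENNReal.ofReal (c / 2 * r ^ n) ≤ volume {y ∈ ball x r | concaveEnv u y - b ≤ u y} := by
  have hsub : ringSector δ ξ \ badSet δ u x p ξ r b ⊆
      (fun z : Rn n => r • z) ⁻¹' ((fun y => x + y) ⁻¹'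
        {y ∈ ball x r | concaveEnv u y - b ≤ u y}) := by
    rintro z ⟨hz1, hz2⟩
    have hz3 : ‖z‖ < 1 := by simpa using hz1.1.1
    have hrz : ‖r • z‖ < r := by
      rw [norm_smul, Real.norm_of_nonneg hr.le]
      nlinarith
    have hge : u x + r * inner ℝ p z - b ≤ u (x + r • z) := not_lt.1 fun h => hz2 ⟨hz1, h⟩
    have h1 := hp _ (add_mem_ball_three hx (h := r • z) (by linarith))
    rw [add_sub_cancel_left, ← show u x = concaveEnv u x from hx.1, real_inner_smul_right] at h1
    refine ⟨by simpa [mem_ball, dist_eq_norm] using hrz, ?_⟩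
    linarith
  have h1 := measure_mono (μ := volume) hsub
  rw [Measure.addHaar_preimage_smul _ hr.ne', measure_preimage_add, finrank_euclideanSpace_fin,
    abs_of_pos (by positivity)] at h1
  have hR : volume (ringSector δ ξ) ≠ ⊤ := (volume_ringSector_lt_top δ ξ).ne
  have h2 : ENNReal.ofReal (c / 2) ≤ volume (ringSector δ ξ \ badSet δ u x p ξ r b) := by
    refine le_trans ?_ le_measure_sdiff
    refine le_trans ?_ (tsub_le_tsub_left (hbad.trans (mul_le_mul_left
      (ENNReal.ofReal_le_ofReal hε1) _)) _)
    have h3 := hcR ξ hξ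
    rw [← ENNReal.ofReal_toReal hR] at h3 ⊢
    rw [← ENNReal.ofReal_mul (by norm_num), ← ENNReal.ofReal_sub _ (by positivity)]
    rw [ENNReal.ofReal_le_ofReal_iff ENNReal.toReal_nonneg] at h3
    refine ENNReal.ofReal_le_ofReal ?_
    linarith
  calc ENNReal.ofReal (c / 2 * r ^ n)
      = ENNReal.ofReal (r ^ n) * ENNReal.ofReal (c / 2) := by
        rw [mul_comm, ENNReal.ofReal_mul (by positivity)]
    _ ≤ ENNReal.ofReal (r ^ n) * (ENNReal.ofReal (r ^ n)⁻¹ *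
        volume {y ∈ ball x r | concaveEnv u y - b ≤ u y}) :=
        mul_le_mul_right (h2.trans h1) _
    _ = _ := by
        rw [← mul_assoc, ← ENNReal.ofReal_mul (by positivity), mul_inv_cancel₀ (by positivity),
          ENNReal.ofReal_one, one_mul]

end Flat

/-! ### A scale that works without error -/

lemma le_volume_sep_of_forall_pos {n : ℕ} {g : Rn n → ℝ} (hg : AEMeasurable g volume) (x : Rn n)
    (r b : ℝ) {a : ENNReal} (h : ∀ e > 0, a ≤ volume {y ∈ ball x r | g y ≤ b + e}) :
    a ≤ volume {y ∈ ball x r | g y ≤ b} := by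
  set A : ℕ → Set (Rn n) := fun j => {y ∈ ball x r | g y ≤ b + 1 / ((j : ℝ) + 1)} with hA
  have hlim := tendsto_measure_iInter_atTop (μ := volume) (s := A)
    (fun j => measurableSet_ball.nullMeasurableSet.inter
      (nullMeasurableSet_le hg aemeasurable_const))
    (fun i j hij y hy => ⟨hy.1, hy.2.trans (by gcongr)⟩)
    ⟨0, ((measure_mono fun y hy => hy.1).trans_lt
      (measure_ball_lt_top (x := x) (r := r))).ne⟩
  refine (ge_of_tendsto' hlim fun j => h _ (by positivity)).trans (measure_mono fun y hy => ?_)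
  rw [mem_iInter] at hy
  refine ⟨(hy 0).1, ge_of_tendsto' (f := fun j : ℕ => b + 1 / ((j : ℝ) + 1))
    (x := Filter.atTop) ?_ fun j => (hy j).2⟩
  simpa using (tendsto_one_div_add_atTop_nhds_zero_nat (𝕜 := ℝ)).const_add b

open Filter Topology in
-- Pigeonhole: if each of the finitely many `k` failed at some `e`, all would fail together at every
-- smaller `e`. This makes the good scale independent of the error.
lemma exists_lt_of_forall_pos {K : ℕ} {P : ℕ → ℝ → Prop}
    (hmono : ∀ k e e', e ≤ e' → P k e → P k e') (h : ∀ e > 0, ∃ k < K, P k e) :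
    ∃ k < K, ∀ e > 0, P k e := by
  by_contra! hcon
  have h1 : ∀ k : Fin K, ∀ᶠ e in 𝓝[>] (0 : ℝ), ¬ P k e := by
    intro k
    obtain ⟨e, he, hPe⟩ := hcon k k.2
    filter_upwards [Ioo_mem_nhdsGT he] with e' he' hP
    exact hPe (hmono _ _ _ he'.2.le hP)
  obtain ⟨e, he, he0⟩ := ((eventually_all.2 h1).and self_mem_nhdsWithin).exists
  obtain ⟨k, hk, hP⟩ := h e he0
  exact he ⟨k, hk⟩ hP

section Scale

variable {n : ℕ} {δ lam Lam α B l : ℝ} {f u : Rn n → ℝ} {x p : Rn n}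

/-- At a contact point there is one of finitely many dyadic scales at which the envelope is flat and
`u` is close to the envelope on a large set. -/
lemma exists_good_scale {ε₀ : ℝ}
    (hl : ∀ ξ : Rn n, ‖ξ‖ = 1 →
      ∀ G : Rn n → ℝ, ConcaveOn ℝ (ball 0 1) G →
      ∀ p ∈ superdiff (ball 0 1) G 0, ∀ b : ℝ, 0 < b →
        volume {z ∈ ringSector δ ξ | G z < G 0 + inner ℝ p z - b} ≤
          ENNReal.ofReal ε₀ * volume (ringSector δ ξ) →
        ∀ y ∈ ball (0 : Rn n) l, G 0 + inner ℝ p y - b ≤ G y)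
    (hlam : 0 < lam) (hLam : lam ≤ Lam) (hα : α ∈ Ioo (0 : ℝ) 2)
    (hu : IsViscositySubsolution δ lam Lam α (ball 0 1) f u) (hum : AEMeasurable u volume)
    (hB : ∀ y, u y ≤ B) (hout : ∀ x ∉ ball (0 : Rn n) 1, u x ≤ 0) (hx : x ∈ contactSet u)
    (hf : 0 ≤ f x) (hp : p ∈ superdiff (ball 0 3) (concaveEnv u) x)
    {t c ε M : ℝ} (ht : 0 < t) (ht1 : t ≤ 1) {K : ℕ}
    (hK : ((2 : ℝ) ^ (-(2 - α))) ^ K ≤ 1 / 2) (hc : 0 < c)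
    (hcR : ∀ ξ : Rn n, ‖ξ‖ = 1 → ENNReal.ofReal c ≤ volume (ringSector δ ξ)) (hε : 0 < ε)
    (hε1 : ε ≤ 1 / 2) (hε₀ : ε ≤ ε₀)
    (hM : 0 < M) (hMlarge : 2 ≤ M * lam * ε * c * (t ^ 2 / 4)) :
    ∃ k < K,
      (∀ y ∈ ball x (l * dyadicScale α t k),
        concaveEnv u x + inner ℝ p (y - x) - M * f x * dyadicScale α t k ^ 2 ≤ concaveEnv u y) ∧
      ENNReal.ofReal (c / 2 * dyadicScale α t k ^ n) ≤
        volume {y ∈ ball x (dyadicScale α t k) |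
          concaveEnv u y - M * f x * dyadicScale α t k ^ 2 ≤ u y} := by
  set r := dyadicScale α t with hr
  have hr0 : ∀ k, 0 < r k := dyadicScale_pos ht
  have hr1 : ∀ k, r k ≤ 1 := fun k => (dyadicScale_le hα.2 ht k).trans ht1
  -- The direction `ξ` no longer occurs in these two properties, so it may vary with `e` as `e → 0`.
  obtain ⟨k, hk, hP⟩ := exists_lt_of_forall_pos (K := K) (P := fun k e =>
      (∀ y ∈ ball x (l * r k),
        concaveEnv u x + inner ℝ p (y - x) - M * (f x + e) * r k ^ 2 ≤ concaveEnv u y) ∧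
      ENNReal.ofReal (c / 2 * r k ^ n) ≤
        volume {y ∈ ball x (r k) | concaveEnv u y - M * (f x + e) * r k ^ 2 ≤ u y})
    (by
      rintro k e e' hee ⟨h1, h2⟩
      have hle : M * (f x + e) * r k ^ 2 ≤ M * (f x + e') * r k ^ 2 := by gcongr
      refine ⟨fun y hy => le_trans (by linarith) (h1 y hy), h2.trans (measure_mono ?_)⟩
      rintro y ⟨hy1, hy2⟩
      exact ⟨hy1, le_trans (by linarith) hy2⟩)
    (by
      intro e he
      obtain ⟨k, hk, ξ, hξ, hbad⟩ := exists_volume_badSet_le hlam hLam hα hu hum hB hout hx hf hp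
        ht ht1 hK hc hcR hε hM hMlarge he
      have hrk := hr0 k
      refine ⟨k, hk, le_concaveEnv_of_volume_badSet_le hl hB hx hp hξ hrk (hr1 k) (by positivity)
        (hbad.trans ?_), le_volume_near_concaveEnv hε1 hcR hx hp hξ hrk (hr1 k) hbad⟩
      exact mul_le_mul_left (ENNReal.ofReal_le_ofReal hε₀) _)
  have hrk := hr0 k
  have herr : ∀ e, M * (f x + e / (M * r k ^ 2)) * r k ^ 2 = M * f x * r k ^ 2 + e := by
    intro e
    field_simp
  refine ⟨k, hk, fun y hy => ?_, ?_⟩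
  · refine le_of_forall_pos_le_add fun e he => ?_
    have := (hP (e / (M * r k ^ 2)) (by positivity)).1 y hy
    rw [herr] at this
    linarith
  · have := le_volume_sep_of_forall_pos (g := fun y => concaveEnv u y - u y)
      ((measurable_concaveEnv hB).aemeasurable.sub hum) x (r k) (M * f x * r k ^ 2)
      (a := ENNReal.ofReal (c / 2 * r k ^ n)) (fun e he => by
        refine (hP (e / (M * r k ^ 2)) (by positivity)).2.trans (measure_mono ?_)
        rintro y ⟨hy1, hy2⟩
        rw [herr] at hy2
        exact ⟨hy1, by linarith⟩)
    refine this.trans (measure_mono ?_)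
    rintro y ⟨hy1, hy2⟩
    exact ⟨hy1, by linarith⟩

/-- Flatness of the envelope near a contact point confines the superdifferentials. -/
lemma mem_closedBall_of_flat (hx : x ∈ contactSet u)
    (hp : p ∈ superdiff (ball 0 3) (concaveEnv u) x) {ρ b : ℝ} (hρ : 0 < ρ) (hρ1 : ρ ≤ 1)
    (hflat : ∀ y ∈ ball x ρ, concaveEnv u x + inner ℝ p (y - x) - b ≤ concaveEnv u y)
    {y q : Rn n} (hy : ‖y - x‖ ≤ ρ / 2) (hq : q ∈ superdiff (ball 0 3) (concaveEnv u) y) :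
    q ∈ closedBall p (4 * b / ρ) := by
  have hb : 0 ≤ b := by
    have := hflat x (mem_ball_self hρ)
    simpa using this
  rw [mem_closedBall, dist_eq_norm]
  rcases eq_or_ne (q - p) 0 with h0 | h0
  · rw [h0, norm_zero]
    positivity
  have hn : 0 < ‖q - p‖ := norm_pos_iff.2 h0
  have h1 := hp y (by
    rw [← add_sub_cancel x y]
    exact add_mem_ball_three hx (by linarith))
  -- Along `w` the plane of slope `q` falls `ρ / 4 * ‖q - p‖` below the one of slope `p`, while
  -- flatness permits a gap of at most `b`.
  set w : Rn n := -((ρ / 4 * ‖q - p‖⁻¹) • (q - p)) with hw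
  have hwn : ‖w‖ = ρ / 4 := by
    rw [hw, norm_neg, norm_smul, Real.norm_of_nonneg (by positivity)]
    field_simp
  have hwx : ‖y + w - x‖ ≤ 3 / 4 * ρ := by
    rw [add_sub_right_comm]
    linarith [norm_add_le (y - x) w]
  have h2 := hflat (y + w) (by rw [mem_ball, dist_eq_norm]; linarith)
  have h3 := hq (y + w) (by
    rw [← add_sub_cancel x (y + w)]
    exact add_mem_ball_three hx (by linarith))
  rw [add_sub_cancel_left] at h3
  rw [show y + w - x = (y - x) + w by abel, inner_add_right] at h2
  have h4 : inner ℝ q w - inner ℝ p w = -(ρ / 4 * ‖q - p‖) := by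
    rw [← inner_sub_left, hw, inner_neg_right, real_inner_smul_right, real_inner_self_eq_norm_sq]
    field_simp
  rw [le_div_iff₀ hρ]
  linarith

end Scale

/-! ### Cubes -/

section Cube

variable {n : ℕ} {c : Rn n} {s : ℝ}

lemma cube_eq_preimage (c : Rn n) (s : ℝ) :
    cube c s = (EuclideanSpace.equiv (Fin n) ℝ) ⁻¹'
      (univ.pi fun i => Ioo (c i - s / 2) (c i + s / 2)) := by
  ext x
  simp only [cube, mem_ofPred_eq, mem_preimage, mem_univ_pi, mem_Ioo, abs_lt]
  refine forall_congr' fun i => ?_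
  simp only [PiLp.coe_continuousLinearEquiv]
  constructor <;> rintro ⟨h1, h2⟩ <;> constructor <;> linarith

lemma closure_cube (hs : 0 < s) (c : Rn n) :
    closure (cube c s) = {x | ∀ i, |x i - c i| ≤ s / 2} := by
  have h := (EuclideanSpace.equiv (Fin n) ℝ).toHomeomorph.preimage_closure
    (univ.pi fun i => Ioo (c i - s / 2) (c i + s / 2))
  rw [cube_eq_preimage]
  refine Eq.trans h.symm ?_
  rw [closure_pi_set]
  ext x
  simp only [mem_preimage, mem_univ_pi, mem_ofPred_eq]
  refine forall_congr' fun i => ?_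
  rw [closure_Ioo (by linarith), mem_Icc, abs_le]
  simp only [ContinuousLinearEquiv.coe_toHomeomorph, PiLp.coe_continuousLinearEquiv]
  constructor <;> rintro ⟨h1, h2⟩ <;> constructor <;> linarith

lemma volume_cube (c : Rn n) (s : ℝ) : volume (cube c s) = ENNReal.ofReal s ^ n := by
  have h := (PiLp.volume_preserving_ofLp (Fin n)).measure_preimage
    (s := univ.pi fun i => Ioo (c i - s / 2) (c i + s / 2))
    (MeasurableSet.univ_pi fun i => measurableSet_Ioo).nullMeasurableSet
  rw [cube_eq_preimage]
  refine Eq.trans h ?_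
  rw [Real.volume_pi_Ioo]
  simp

lemma norm_le_sqrt_mul {z : Rn n} (hs : 0 ≤ s) (h : ∀ i, |z i| ≤ s) : ‖z‖ ≤ √(n : ℝ) * s := by
  rw [EuclideanSpace.norm_eq]
  calc √(∑ i, ‖z i‖ ^ 2) ≤ √(∑ _i : Fin n, s ^ 2) := by
        refine Real.sqrt_le_sqrt (Finset.sum_le_sum fun i _ => ?_)
        rw [Real.norm_eq_abs]
        exact pow_le_pow_left₀ (abs_nonneg _) (h i) 2
    _ = √(n : ℝ) * s := by
        rw [Finset.sum_const, Finset.card_univ, Fintype.card_fin, nsmul_eq_mul,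
          Real.sqrt_mul (Nat.cast_nonneg n), Real.sqrt_sq hs]

lemma norm_sub_le_of_mem_closure_cube (hs : 0 < s) {x y : Rn n} (hx : x ∈ closure (cube c s))
    (hy : y ∈ closure (cube c s)) : ‖y - x‖ ≤ √(n : ℝ) * s := by
  rw [closure_cube hs] at hx hy
  refine norm_le_sqrt_mul hs.le fun i => ?_
  have h1 := hx i
  have h2 := hy i
  rw [abs_le] at h1 h2 ⊢
  rw [PiLp.sub_apply]
  constructor <;> linarith

lemma diam_cube_le (hs : 0 < s) (c : Rn n) : diam (cube c s) ≤ √(n : ℝ) * s :=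
  diam_le_of_forall_dist_le (by positivity) fun x hx y hy => by
    rw [dist_comm, dist_eq_norm]
    exact norm_sub_le_of_mem_closure_cube hs (subset_closure hx) (subset_closure hy)

lemma half_le_diam_cube (hn : 1 ≤ n) (hs : 0 < s) (c : Rn n) : s / 2 ≤ diam (cube c s) := by
  let i₀ : Fin n := ⟨0, hn⟩
  have hb : Bornology.IsBounded (closure (cube c s)) :=
    isBounded_iff.2 ⟨√(n : ℝ) * s, fun x hx y hy => by
      rw [dist_comm, dist_eq_norm]
      exact norm_sub_le_of_mem_closure_cube hs hx hy⟩
  have h1 : c ∈ closure (cube c s) := subset_closure fun i => by simp [hs]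
  have h2 : c + EuclideanSpace.single i₀ (s / 2) ∈ closure (cube c s) := by
    rw [closure_cube hs]
    intro i
    rcases eq_or_ne i i₀ with rfl | hi
    · simp [abs_of_pos (half_pos hs)]
    · simp [hi, (half_pos hs).le]
  have h3 := dist_le_diam_of_mem hb h2 h1
  rw [diam_closure, dist_eq_norm, add_sub_cancel_left, PiLp.norm_single,
    Real.norm_of_nonneg (by linarith)] at h3
  exact h3

lemma exists_fin_le_le_add_one {N : ℕ} (hN : 0 < N) {t : ℝ} (h0 : 0 ≤ t) (h1 : t ≤ N) :
    ∃ a : Fin N, (a : ℝ) ≤ t ∧ t ≤ a + 1 := by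
  rcases eq_or_lt_of_le h1 with rfl | h1
  · refine ⟨⟨N - 1, by omega⟩, ?_⟩
    have : ((N - 1 : ℕ) : ℝ) = N - 1 := by rw [Nat.cast_sub hN]; simp
    constructor <;> simp [this]
  · exact ⟨⟨⌊t⌋₊, (Nat.floor_lt h0).2 h1⟩, Nat.floor_le h0, (Nat.lt_floor_add_one t).le⟩

/-- A cube is subdivided into `Nⁿ` cubes of equal size. -/
lemma exists_cube_subdivision (c : Rn n) (hs : 0 < s) {N : ℕ} (hN : 0 < N) :
    ∃ g : (Fin n → Fin N) → Rn n, (∀ a, cube (g a) (s / N) ⊆ cube c s) ∧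
      Pairwise (Function.onFun Disjoint fun a => cube (g a) (s / N)) ∧
      closure (cube c s) ⊆ ⋃ a, closure (cube (g a) (s / N)) := by
  have hN' : (0 : ℝ) < N := by exact_mod_cast hN
  set h := s / N with hh
  have hh0 : 0 < h := by positivity
  have hNh : N * h = s := by rw [hh]; field_simp
  refine ⟨fun a => WithLp.toLp 2 fun i => c i - s / 2 + ((a i : ℝ) + 1 / 2) * h, ?_, ?_, ?_⟩
  · intro a x hx i
    have h1 := hx i
    have h2 : ((a i : ℕ) : ℝ) + 1 ≤ N := by exact_mod_cast (a i).2
    have h3 : (0 : ℝ) ≤ ((a i : ℕ) : ℝ) := Nat.cast_nonneg _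
    rw [abs_lt] at h1 ⊢
    simp only at h1
    constructor <;> nlinarith
  · intro a b hab
    refine Set.disjoint_left.2 fun x hxa hxb => hab (funext fun i => ?_)
    have h1 := hxa i
    have h2 := hxb i
    rw [abs_lt] at h1 h2
    simp only at h1 h2
    by_contra hne
    rcases lt_or_gt_of_ne hne with hlt | hlt
    · have h3 : ((a i : ℕ) : ℝ) + 1 ≤ ((b i : ℕ) : ℝ) := by exact_mod_cast hlt
      nlinarith
    · have h3 : ((b i : ℕ) : ℝ) + 1 ≤ ((a i : ℕ) : ℝ) := by exact_mod_cast hlt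
      nlinarith
  · intro x hx
    rw [closure_cube hs] at hx
    have hex : ∀ i, ∃ a : Fin N, (a : ℝ) ≤ (x i - c i + s / 2) / h ∧
        (x i - c i + s / 2) / h ≤ a + 1 := by
      intro i
      have h1 := abs_le.1 (hx i)
      refine exists_fin_le_le_add_one hN (div_nonneg (by linarith) hh0.le) ?_
      rw [div_le_iff₀ hh0, hNh]
      linarith
    choose a ha1 ha2 using hex
    refine mem_iUnion.2 ⟨a, ?_⟩
    rw [closure_cube hh0]
    intro i
    have h1 := ha1 i
    have h2 := ha2 i
    rw [le_div_iff₀ hh0] at h1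
    rw [div_le_iff₀ hh0] at h2
    rw [abs_le]
    simp only
    constructor <;> nlinarith

/-- `T` is a finite family of pairwise disjoint good cubes in `E`, of side length at most `s`, each
of which meets `S`, whose closures cover `S ∩ A`. -/
structure IsGoodCover (S : Set (Rn n)) (Good : Rn n → ℝ → Prop) (s : ℝ) (E A : Set (Rn n))
    (T : Finset (Rn n × ℝ)) : Prop where
  pos : ∀ q ∈ T, 0 < q.2
  le : ∀ q ∈ T, q.2 ≤ s
  subset : ∀ q ∈ T, cube q.1 q.2 ⊆ E
  nonempty : ∀ q ∈ T, (S ∩ closure (cube q.1 q.2)).Nonempty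
  good : ∀ q ∈ T, Good q.1 q.2
  disjoint : (T : Set (Rn n × ℝ)).PairwiseDisjoint fun q => cube q.1 q.2
  cover : S ∩ A ⊆ ⋃ q ∈ T, closure (cube q.1 q.2)

variable {S : Set (Rn n)} {Good : Rn n → ℝ → Prop}

/-- Confinement of each family to its own container `E a` is what makes cubes from different
families disjoint. -/
lemma IsGoodCover.exists_iUnion {ι : Type*} [Fintype ι] {s s' : ℝ} (hs : s' ≤ s)
    {E A : ι → Set (Rn n)} {E' A' : Set (Rn n)} (hE : ∀ a, E a ⊆ E')
    (hdisj : Pairwise (Function.onFun Disjoint E)) (hA : A' ⊆ ⋃ a, A a)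
    (h : ∀ a, ∃ T, IsGoodCover S Good s' (E a) (A a) T) :
    ∃ T, IsGoodCover S Good s E' A' T := by
  classical
  choose T hT using h
  have hmem : ∀ q ∈ Finset.univ.biUnion T, ∃ a, q ∈ T a := by simp
  refine ⟨Finset.univ.biUnion T, ?_, ?_, ?_, ?_, ?_, ?_, ?_⟩
  · intro q hq
    obtain ⟨a, ha⟩ := hmem q hq
    exact (hT a).pos q ha
  · intro q hq
    obtain ⟨a, ha⟩ := hmem q hq
    exact ((hT a).le q ha).trans hs
  · intro q hq
    obtain ⟨a, ha⟩ := hmem q hq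
    exact ((hT a).subset q ha).trans (hE a)
  · intro q hq
    obtain ⟨a, ha⟩ := hmem q hq
    exact (hT a).nonempty q ha
  · intro q hq
    obtain ⟨a, ha⟩ := hmem q hq
    exact (hT a).good q ha
  · intro q hq q' hq' hne
    obtain ⟨a, ha⟩ := hmem q hq
    obtain ⟨a', ha'⟩ := hmem q' hq'
    rcases eq_or_ne a a' with rfl | haa
    · exact (hT a).disjoint ha ha' hne
    · exact (hdisj haa).mono ((hT a).subset q ha) ((hT a').subset q' ha')
  · rintro x ⟨hxS, hxA⟩
    obtain ⟨a, ha⟩ := mem_iUnion.1 (hA hxA)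
    obtain ⟨q, hq, hxq⟩ := mem_iUnion₂.1 ((hT a).cover ⟨hxS, ha⟩)
    exact mem_iUnion₂.2 ⟨q, Finset.mem_biUnion.2 ⟨a, Finset.mem_univ _, hq⟩, hxq⟩

/-- Bisection of a cube until the subcubes are good or do not meet `S`. -/
lemma exists_isGoodCover_cube (J : ℕ) : ∀ (c : Rn n) (s : ℝ), 0 < s →
    (∀ x ∈ S ∩ closure (cube c s), ∃ k ≤ J, ∀ c', x ∈ closure (cube c' (s / 2 ^ k)) →
      Good c' (s / 2 ^ k)) →
    ∃ T, IsGoodCover S Good s (cube c s) (closure (cube c s)) T := by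
  classical
  induction J with
  | zero =>
    intro c s hs h
    rcases (S ∩ closure (cube c s)).eq_empty_or_nonempty with he | ⟨x, hx⟩
    · exact ⟨∅, by simp, by simp, by simp, by simp, by simp, by simp, by simp [he]⟩
    · have hg : Good c s := by
        obtain ⟨k, hk, hgood⟩ := h x hx
        obtain rfl : k = 0 := by omega
        simpa using hgood c (by simpa using hx.2)
      exact ⟨{(c, s)}, by simpa using hs, by simp, by simp, by simpa using ⟨x, hx⟩,
        by simpa using hg, by simp, by simp⟩
  | succ J ih =>
    intro c s hs h
    rcases (S ∩ closure (cube c s)).eq_empty_or_nonempty with he | ⟨x, hx⟩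
    · exact ⟨∅, by simp, by simp, by simp, by simp, by simp, by simp, by simp [he]⟩
    by_cases hg : Good c s
    · exact ⟨{(c, s)}, by simpa using hs, by simp, by simp, by simpa using ⟨x, hx⟩,
        by simpa using hg, by simp, by simp⟩
    obtain ⟨g, hg1, hg2, hg3⟩ := exists_cube_subdivision c hs two_pos
    refine IsGoodCover.exists_iUnion (s' := s / (2 : ℕ)) (half_le_self hs.le) hg1 hg2 hg3
      fun a => ih (g a) (s / (2 : ℕ)) (half_pos hs) ?_
    rintro y ⟨hyS, hy⟩
    have hyc : y ∈ closure (cube c s) := closure_mono (hg1 a) hy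
    obtain ⟨k, hk, hgood⟩ := h y ⟨hyS, hyc⟩
    -- Depth `0` is excluded since the present cube is not good, so the good depth of `y` drops by
    -- one in the subcube.
    obtain ⟨k, rfl⟩ : ∃ m, k = m + 1 := by
      refine Nat.exists_eq_succ_of_ne_zero fun h0 => hg ?_
      subst h0
      simpa using hgood c (by simpa using hyc)
    refine ⟨k, by omega, fun c' hc' => ?_⟩
    have hside : s / (2 : ℕ) / 2 ^ k = s / 2 ^ (k + 1) := by
      rw [pow_succ, div_div, mul_comm]; norm_num
    rw [hside] at hc' ⊢
    exact hgood c' hc'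

/-- The covering of a bounded set by good cubes of side length at most `s`. -/
lemma exists_isGoodCover (J : ℕ) (hs : 0 < s) (hS : S ⊆ ball 0 1)
    (h : ∀ x ∈ S, ∃ k ≤ J, ∀ c', x ∈ closure (cube c' (s / 2 ^ k)) → Good c' (s / 2 ^ k)) :
    ∃ T, IsGoodCover S Good s univ univ T := by
  -- The cube of side `N * s > 2` about the origin contains `B₁`.
  obtain ⟨N, hN⟩ := exists_nat_gt (2 / s)
  have hN0 : (0 : ℝ) < N := (by positivity : 0 < 2 / s).trans hN
  have hNs : 2 < N * s := (div_lt_iff₀ hs).1 hN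
  have hdiv : N * s / N = s := by field_simp
  obtain ⟨g, -, hg2, hg3⟩ := exists_cube_subdivision (0 : Rn n) (mul_pos hN0 hs)
    (Nat.cast_pos.1 hN0)
  rw [hdiv] at hg2 hg3
  obtain ⟨T, hT⟩ := IsGoodCover.exists_iUnion le_rfl (fun a => subset_univ _) hg2 hg3
    fun a => exists_isGoodCover_cube J (g a) s hs fun x hx => h x hx.1
  refine ⟨T, hT.pos, hT.le, hT.subset, hT.nonempty, hT.good, hT.disjoint, ?_⟩
  refine fun x hx => hT.cover ⟨hx.1, subset_closure fun i => ?_⟩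
  have h1 := PiLp.norm_apply_le x i
  have h2 : ‖x‖ < 1 := by simpa using hS hx.1
  rw [Real.norm_eq_abs] at h1
  simp only [PiLp.zero_apply, sub_zero]
  linarith

end Cube

/-! ### The two estimates on a good cube -/

section GoodCube

variable {n : ℕ} {l M C F s : ℝ} {u : Rn n → ℝ} {x p c : Rn n}

/-- The measure estimate for the superdifferentials and the density estimate on a cube of side
length `s`, where `F` is the supremum of the right-hand side. -/
def CubeEstimates (u : Rn n → ℝ) (l C ν F : ℝ) (c : Rn n) (s : ℝ) : Prop :=
  volume (gradImage u (closure (cube c s))) ≤ ENNReal.ofReal (C * F ^ n) * volume (cube c s) ∧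
  ENNReal.ofReal ν * volume (cube c ((1 + 8 / l) * √(n : ℝ) * s)) ≤
    volume {y ∈ cube c ((1 + 8 / l) * √(n : ℝ) * s) |
      concaveEnv u y - C * F * diam (cube c s) ^ 2 ≤ u y}

/-- At radius `(2√n / l) s` the envelope is flat on a ball of radius `2√n s`; the closed cube lies
within half of that from `x`, as `mem_closedBall_of_flat` requires. -/
lemma volume_gradImage_le (hl : 0 < l) (hl1 : l < 1)
    (hx : x ∈ contactSet u) (hp : p ∈ superdiff (ball 0 3) (concaveEnv u) x) {a : ℝ} (ha : 0 ≤ a)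
    (hM : 0 ≤ M) (haF : a ≤ F) (hn : 1 ≤ n) (hs : 0 < s) (hs1 : 2 * √(n : ℝ) / l * s ≤ 1)
    (hxc : x ∈ closure (cube c s))
    (hC : (8 * M * √(n : ℝ) / l ^ 2) ^ n * (volume (ball (0 : Rn n) 1)).toReal ≤ C)
    (hflat : ∀ y ∈ ball x (l * (2 * √(n : ℝ) / l * s)),
      concaveEnv u x + inner ℝ p (y - x) - M * a * (2 * √(n : ℝ) / l * s) ^ 2 ≤ concaveEnv u y) :
    volume (gradImage u (closure (cube c s))) ≤ ENNReal.ofReal (C * F ^ n) * volume (cube c s) := by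
  have hn0 : 0 < √(n : ℝ) := Real.sqrt_pos.2 (by exact_mod_cast hn)
  have hr : l * (2 * √(n : ℝ) / l * s) = 2 * √(n : ℝ) * s := by field_simp
  have hr1 : 2 * √(n : ℝ) * s ≤ 1 := by
    rw [← hr]
    nlinarith
  rw [hr] at hflat
  have hsub : gradImage u (closure (cube c s)) ⊆
      closedBall p (8 * M * √(n : ℝ) / l ^ 2 * a * s) := by
    refine iUnion₂_subset fun y hy q hq => ?_
    have := mem_closedBall_of_flat hx hp (by positivity) hr1 hflat (y := y) (q := q)
      (by linarith [norm_sub_le_of_mem_closure_cube hs hxc hy]) hq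
    refine closedBall_subset_closedBall (le_of_eq ?_) this
    field_simp
    ring
  refine (measure_mono hsub).trans ?_
  rw [Measure.addHaar_closedBall _ _ (by positivity), finrank_euclideanSpace_fin, volume_cube,
    ← ENNReal.ofReal_toReal (a := volume (ball (0 : Rn n) 1)) measure_ball_lt_top.ne,
    ← ENNReal.ofReal_pow hs.le, ← ENNReal.ofReal_mul (by positivity)]
  have hF : 0 ≤ F := ha.trans haF
  have hC0 : 0 ≤ C := le_trans (by positivity) hC
  rw [← ENNReal.ofReal_mul (by positivity)]
  refine ENNReal.ofReal_le_ofReal ?_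
  set ω := (volume (ball (0 : Rn n) 1)).toReal
  have hω : 0 ≤ ω := ENNReal.toReal_nonneg
  calc (8 * M * √(n : ℝ) / l ^ 2 * a * s) ^ n * ω
      = (8 * M * √(n : ℝ) / l ^ 2) ^ n * ω * a ^ n * s ^ n := by rw [mul_pow, mul_pow]; ring
    _ ≤ C * F ^ n * s ^ n := by gcongr

lemma ball_subset_cube_of_mem_closure (hl : 0 < l) (hn : 1 ≤ n) (hs : 0 < s)
    (hxc : x ∈ closure (cube c s)) :
    ball x (2 * √(n : ℝ) / l * s) ⊆ cube c ((1 + 8 / l) * √(n : ℝ) * s) := by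
  have hn1 : 1 ≤ √(n : ℝ) := Real.one_le_sqrt.2 (by exact_mod_cast hn)
  intro y hy i
  rw [mem_ball, dist_eq_norm] at hy
  rw [closure_cube hs] at hxc
  have h1 := hxc i
  have h2 := PiLp.norm_apply_le (y - x) i
  rw [PiLp.sub_apply, Real.norm_eq_abs] at h2
  have h3 := abs_sub_le (y i) (x i) (c i)
  have h4 : s ≤ √(n : ℝ) * s := le_mul_of_one_le_left hs.le hn1
  have h5 : (1 + 8 / l) * √(n : ℝ) * s / 2 = √(n : ℝ) * s / 2 + 2 * (2 * √(n : ℝ) / l * s) := by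
    ring
  have h6 : 0 < 2 * √(n : ℝ) / l * s := by positivity
  linarith

/-- The ball of radius `(2√n / l) s` about `x` fits in the enlarged cube, and `2 / (l + 8)` is the
ratio of its radius to the side of that cube. -/
lemma le_volume_near_concaveEnv_cube (hl : 0 < l) {a m : ℝ} (ha : 0 ≤ a) (hm : 0 < m)
    (hM : 0 ≤ M) (haF : a ≤ F) (hn : 1 ≤ n) (hs : 0 < s) (hxc : x ∈ closure (cube c s))
    (hC : 16 * M * n / l ^ 2 ≤ C)
    (hvol : ENNReal.ofReal (m * (2 * √(n : ℝ) / l * s) ^ n) ≤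
      volume {y ∈ ball x (2 * √(n : ℝ) / l * s) |
        concaveEnv u y - M * a * (2 * √(n : ℝ) / l * s) ^ 2 ≤ u y}) :
    ENNReal.ofReal (m * (2 / (l + 8)) ^ n) * volume (cube c ((1 + 8 / l) * √(n : ℝ) * s)) ≤
      volume {y ∈ cube c ((1 + 8 / l) * √(n : ℝ) * s) |
        concaveEnv u y - C * F * diam (cube c s) ^ 2 ≤ u y} := by
  have hη : 2 / (l + 8) * ((1 + 8 / l) * √(n : ℝ) * s) = 2 * √(n : ℝ) / l * s := by
    field_simp
  rw [volume_cube, ← ENNReal.ofReal_pow (by positivity), ← ENNReal.ofReal_mul (by positivity),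
    mul_assoc, ← mul_pow, hη]
  refine hvol.trans (measure_mono ?_)
  rintro y ⟨hy1, hy2⟩
  refine ⟨ball_subset_cube_of_mem_closure hl hn hs hxc hy1, le_trans ?_ hy2⟩
  have hd := half_le_diam_cube hn hs c
  have hC0 : 0 ≤ C := le_trans (by positivity) hC
  have h1 : M * a * (2 * √(n : ℝ) / l * s) ^ 2 = 16 * M * n / l ^ 2 * a * (s / 2) ^ 2 := by
    rw [mul_pow, div_pow, mul_pow, Real.sq_sqrt (Nat.cast_nonneg n)]
    ring
  have h2 : 16 * M * n / l ^ 2 * a * (s / 2) ^ 2 ≤ C * F * diam (cube c s) ^ 2 := by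
    have hF : 0 ≤ F := ha.trans haF
    gcongr
  linarith

end GoodCube

lemma le_supOn {n : ℕ} {f : Rn n → ℝ} (hf : ContinuousOn f (closedBall 0 1)) {E : Set (Rn n)}
    {x : Rn n} (hxE : x ∈ E) (hx : x ∈ closedBall (0 : Rn n) 1) : f x ≤ supOn f E := by
  obtain ⟨b, hb⟩ := (isCompact_closedBall (0 : Rn n) 1).bddAbove_image hf
  refine le_csSup ⟨b, ?_⟩ ⟨x, ⟨hxE, hx⟩, rfl⟩
  rintro _ ⟨y, hy, rfl⟩
  exact hb ⟨y, hy.2, rfl⟩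

/-- The constant `M` of the ring estimate. -/
noncomputable def ringConst (lam ε c t : ℝ) : ℝ := 8 / (lam * ε * c * t ^ 2)

/-- The constant of the two estimates on the cubes. -/
noncomputable def cubeConst (n : ℕ) (l M : ℝ) : ℝ :=
  max 1 (max ((8 * M * √(n : ℝ) / l ^ 2) ^ n * (volume (ball (0 : Rn n) 1)).toReal)
    (16 * M * n / l ^ 2))

lemma dyadicScale_eq_mul {α l ρ₀ : ℝ} {n : ℕ} (hl : 0 < l) (hn : 1 ≤ n) (k : ℕ) :
    dyadicScale α (2 * ρ₀ / l) k =
      2 * √(n : ℝ) / l * (dyadicScale α (ρ₀ / √(n : ℝ)) 0 / 2 ^ k) := by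
  have hn0 : 0 < √(n : ℝ) := Real.sqrt_pos.2 (by exact_mod_cast hn)
  rw [dyadicScale, dyadicScale]
  field_simp

end NonlocalABP

theorem theorem4p8 (n : ℕ) (hn : 1 ≤ n) (δ : ℝ) (hδ : δ ∈ Set.Ioo (0 : ℝ) 1) :
    (∃ l : ℝ, NonlocalABP.IsSectorRadius n δ l) ∧
    ∀ l : ℝ, NonlocalABP.IsSectorRadius n δ l →
    ∃ ν : ℝ, 0 < ν ∧
    ∀ lam : ℝ, 0 < lam → ∀ ρ₀ : ℝ, 0 < ρ₀ → ρ₀ ≤ l / (16 * n) →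
    ∃ C₂ : ℝ, 1 ≤ C₂ ∧
    ∀ Lam : ℝ, lam ≤ Lam → ∀ α ∈ Set.Ioo (0 : ℝ) 2,
    ∀ f u : NonlocalABP.Rn n → ℝ,
      ContinuousOn f (Metric.closedBall 0 1) →
      (∀ x ∈ Metric.closedBall (0 : NonlocalABP.Rn n) 1, 0 ≤ f x) →
      AEMeasurable u MeasureTheory.volume →
      NonlocalABP.IsViscositySubsolution δ lam Lam α (Metric.ball 0 1) f u →
      (∀ x ∉ Metric.ball (0 : NonlocalABP.Rn n) 1, u x ≤ 0) →
      ∃ (m : ℕ) (c : Fin m → NonlocalABP.Rn n) (s : Fin m → ℝ),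
        (∀ j, 0 < s j) ∧
        (∀ i j, i ≠ j → Disjoint (NonlocalABP.cube (c i) (s i)) (NonlocalABP.cube (c j) (s j))) ∧
        NonlocalABP.contactSet u ⊆ ⋃ j, closure (NonlocalABP.cube (c j) (s j)) ∧
        ∀ j,
          0 < Metric.diam (NonlocalABP.cube (c j) (s j)) ∧
          Metric.diam (NonlocalABP.cube (c j) (s j)) ≤ ρ₀ * (2 : ℝ) ^ (-1 / (2 - α)) ∧
          (NonlocalABP.contactSet u ∩ closure (NonlocalABP.cube (c j) (s j))).Nonempty ∧
          MeasureTheory.volume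
              (NonlocalABP.gradImage u (closure (NonlocalABP.cube (c j) (s j)))) ≤
            ENNReal.ofReal
                (C₂ * NonlocalABP.supOn f (closure (NonlocalABP.cube (c j) (s j))) ^ n) *
              MeasureTheory.volume (NonlocalABP.cube (c j) (s j)) ∧
          ENNReal.ofReal ν *
              MeasureTheory.volume
                (NonlocalABP.cube (c j) ((1 + 8 / l) * √(n : ℝ) * s j)) ≤
            MeasureTheory.volume
              {y ∈ NonlocalABP.cube (c j) ((1 + 8 / l) * √(n : ℝ) * s j) |
                NonlocalABP.concaveEnv u y -
                    C₂ * NonlocalABP.supOn f (closure (NonlocalABP.cube (c j) (s j))) *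
                      Metric.diam (NonlocalABP.cube (c j) (s j)) ^ 2 ≤ u y} := by
  refine ⟨NonlocalABP.exists_isSectorRadius n hδ, ?_⟩
  rintro l ⟨hl0, hl1, ε₀, hε₀, hl⟩
  obtain ⟨c, hc, hcR⟩ := NonlocalABP.exists_volume_ringSector_ge n hδ
  have hn0 : 0 < √(n : ℝ) := Real.sqrt_pos.2 (by exact_mod_cast hn)
  have hn1 : (1 : ℝ) ≤ n := by exact_mod_cast hn
  refine ⟨c / 2 * (2 / (l + 8)) ^ n, by positivity, fun lam hlam ρ₀ hρ₀ hρ₁ => ?_⟩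
  set ε := min ε₀ (1 / 2) with hε
  have hε0 : 0 < ε := lt_min hε₀ (by norm_num)
  -- Chosen so that the ring radius at level `k` is `2√n / l` times the side of a cube bisected `k`
  -- times.
  set t := 2 * ρ₀ / l with ht
  have ht0 : 0 < t := by positivity
  have ht1 : t ≤ 1 := by
    rw [le_div_iff₀ (by positivity)] at hρ₁
    rw [ht, div_le_one hl0]
    nlinarith
  set M := NonlocalABP.ringConst lam ε c t with hM
  have hM0 : 0 < M := by rw [hM, NonlocalABP.ringConst]; positivity
  have hMlarge : 2 ≤ M * lam * ε * c * (t ^ 2 / 4) := by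
    refine le_of_eq ?_
    rw [hM, NonlocalABP.ringConst]
    field_simp
    norm_num
  set C := NonlocalABP.cubeConst n l M with hC
  refine ⟨C, le_max_left _ _, fun Lam hLam α hα f u hfc hf hum hu hout => ?_⟩
  obtain ⟨B, hB⟩ := NonlocalABP.exists_forall_le_of_isViscositySubsolution hu hout
  obtain ⟨K, hK⟩ := NonlocalABP.exists_pow_rpow_neg_le_half hα.2
  -- Here `√n * s₀ = ρ₀ 2^(-1/(2-α))`, the largest diameter allowed.
  set s₀ := NonlocalABP.dyadicScale α (ρ₀ / √(n : ℝ)) 0 with hs₀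
  have hs₀0 : 0 < s₀ := NonlocalABP.dyadicScale_pos (by positivity) 0
  obtain ⟨T, hT⟩ := NonlocalABP.exists_isGoodCover (S := NonlocalABP.contactSet u)
    (Good := fun c' s => NonlocalABP.CubeEstimates u l C (c / 2 * (2 / (l + 8)) ^ n)
      (NonlocalABP.supOn f (closure (NonlocalABP.cube c' s))) c' s) K hs₀0 (fun x hx => hx.2) (by
    intro x hx
    have hx1 : x ∈ Metric.closedBall (0 : NonlocalABP.Rn n) 1 := Metric.ball_subset_closedBall hx.2
    obtain ⟨p, hp⟩ := NonlocalABP.exists_superdiff Metric.isOpen_ball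
      (NonlocalABP.concaveOn_concaveEnv hB)
      (Metric.ball_subset_ball (by norm_num) (NonlocalABP.mem_ball_of_mem_contactSet hx))
    obtain ⟨k, hk, hflat, hvol⟩ := NonlocalABP.exists_good_scale hl hlam hLam hα hu hum hB hout hx
      (hf x hx1) hp ht0 ht1 hK hc hcR hε0 (min_le_right _ _) (min_le_left _ _) hM0 hMlarge
    refine ⟨k, hk.le, fun c' hxc => ?_⟩
    have hr1 := (NonlocalABP.dyadicScale_le hα.2 ht0 k).trans ht1
    rw [NonlocalABP.dyadicScale_eq_mul hl0 hn, ← hs₀] at hflat hvol hr1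
    have hs : 0 < s₀ / 2 ^ k := by positivity
    have hfx := NonlocalABP.le_supOn hfc hxc hx1
    exact ⟨NonlocalABP.volume_gradImage_le hl0 (by linarith) hx hp (hf x hx1) hM0.le hfx hn hs hr1
        hxc ((le_max_left _ _).trans (le_max_right _ _)) hflat,
      NonlocalABP.le_volume_near_concaveEnv_cube hl0 (hf x hx1) (by positivity) hM0.le hfx hn hs hxc
        ((le_max_right _ _).trans (le_max_right _ _)) hvol⟩)
  let e := T.equivFin.symm
  refine ⟨T.card, fun j => (e j).1.1, fun j => (e j).1.2, fun j => hT.pos _ (e j).2,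
    fun i j hij => hT.disjoint (e i).2 (e j).2 fun h => hij (e.injective (Subtype.ext h)), ?_, ?_⟩
  · intro x hx
    obtain ⟨q, hq, hxq⟩ := Set.mem_iUnion₂.1 (hT.cover ⟨hx, Set.mem_univ _⟩)
    refine Set.mem_iUnion.2 ⟨T.equivFin ⟨q, hq⟩, ?_⟩
    simpa [e] using hxq
  · intro j
    have hpos := hT.pos _ (e j).2
    refine ⟨(half_pos hpos).trans_le (NonlocalABP.half_le_diam_cube hn hpos _), ?_,
      hT.nonempty _ (e j).2, (hT.good _ (e j).2).1, (hT.good _ (e j).2).2⟩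
    refine (NonlocalABP.diam_cube_le hpos _).trans ?_
    have hle := mul_le_mul_of_nonneg_left (hT.le _ (e j).2) hn0.le
    refine hle.trans (le_of_eq ?_)
    rw [hs₀, NonlocalABP.dyadicScale]
    field_simp
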